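/- Work over $\mathbb{C}$. Let $V_6 = Q\cap F\subset\mathbb{P}^5$ be a prime Fano threefold of genus $4$, i.e. a smooth (scheme-theoretic) complete intersection threefold of a quadric $Q$ and a cubic hypersurface $F$. A plane cubic is the divisor, in a plane $\mathbb{P}^2\subset\mathbb{P}^5$, of a cubic form not vanishing identically on that plane (it may be reducible or non-reduced). A $\mathbb{P}^3$-family of planes is a closed embedding $t\mapsto \mathbb{P}^2(t)$ of $\mathbb{P}^3$ into the Grassmannian of planes in $\mathbb{P}^5$. (1) If $\operatorname{rk}(Q)=6$, then the planes on $Q$ form two disjoint $\mathbb{P}^3$-families $\Lambda_1=\{\mathbb{P}^2_1(t)\}$, $\Lambda_2=\{\mathbb{P}^2_2(t)\}$ (every plane on $Q$ belongs to exactly one of them). For every $V_6=Q\cap F$ and $i=1,2$, each scheme $V_6\cap\mathbb{P}^2_i(t)$ is a plane cubic; distinct $t$ give distinct plane cubics, no plane cubic arises from both families, and every plane cubic contained in $V_6$ arises in this way. So there lie on $V_6$ exactly two $\mathbb{P}^3$-families of plane cubics, cut out by the two families of planes on $Q$. Moreover, if $V_6$ is general (on each fixed $Q$ of rank $6$: for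 $F$ in a Zariski open set of cubics containing one for which $Q\cap F$ is a smooth threefold), then the general element of each of these two families is a smooth plane cubic curve. (2) If $\operatorname{rk}(Q)=5$, then the planes on $Q$ form a single $\mathbb{P}^3$-family $\Lambda=\{\mathbb{P}^2(t)\}$. For every $V_6=Q\cap F$ each scheme $V_6\cap\mathbb{P}^2(t)$ is a plane cubic, distinct $t$ give distinct plane cubics, and every plane cubic contained in $V_6$ arises in this way. So there lies on $V_6$ exactly one $\mathbb{P}^3$-family of plane cubics, cut out by the unique family of planes on $Q$. Moreover, if $V_6$ is general (on each fixed $Q$ of rank $5$, in the same sense), then the general plane cubic on $V_6$ is a smooth plane cubic curve. -/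

import Mathlib

namespace FanoGenusFour

/-- The homogeneous coordinate ring `ℂ[x₀, …, x₅]` of `ℙ⁵`. Closed subschemes of `ℙ⁵` are given
by homogeneous ideals of this ring. -/
abbrev Coord : Type := MvPolynomial (Fin 6) ℂ

/-- The differential `v ↦ ∑ᵢ (∂p/∂xᵢ)(x) vᵢ` of a polynomial `p` at the point `x`. -/
noncomputable def differential {n : ℕ} (p : MvPolynomial (Fin n) ℂ) (x : Fin n → ℂ) :
    (Fin n → ℂ) →ₗ[ℂ] ℂ :=
  ∑ i, (MvPolynomial.eval x (MvPolynomial.pderiv i p)) • LinearMap.proj i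

/-- The Zariski tangent space at `x` of the affine cone defined by the ideal `I`. For `x ≠ 0`
its dimension is one more than that of the Zariski tangent space of the projective scheme
defined by `I` at the point `[x]`. -/
noncomputable def tangentSpace (I : Ideal Coord) (x : Fin 6 → ℂ) : Submodule ℂ (Fin 6 → ℂ) :=
  ⨅ p ∈ I, LinearMap.ker (differential p x)

/-- Jacobian criterion: every Zariski tangent space of the closed subscheme of `ℙ⁵` defined
by `I` has dimension `d`. For a scheme all of whose components have dimension at least `d`
(such as one cut out by `5 - d` equations) this says that it is smooth of dimension `d`. -/
def IsSmoothOfDim (I : Ideal Coord) (d : ℕ) : Prop :=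
  ∀ x : Fin 6 → ℂ, x ≠ 0 → (∀ p ∈ I, MvPolynomial.eval x p = 0) →
    Module.finrank ℂ (tangentSpace I x) = d + 1

/-- `V = Q ∩ F ⊂ ℙ⁵`, with `Q = {q = 0}` a quadric and `F = {f = 0}` a cubic, is a smooth
threefold. These `V` are exactly the (anticanonically embedded) prime Fano threefolds of
genus `4`. -/
def IsV6 (q f : Coord) : Prop :=
  q.IsHomogeneous 2 ∧ f.IsHomogeneous 3 ∧ IsSmoothOfDim (Ideal.span {q, f}) 3

/-- The rank of a quadratic form `q`, i.e. of its (constant) Hessian matrix. -/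
noncomputable def quadricRank (q : Coord) : ℕ :=
  (Matrix.of fun i j : Fin 6 =>
    MvPolynomial.constantCoeff (MvPolynomial.pderiv i (MvPolynomial.pderiv j q))).rank

/-- The planes `ℙ(W) ⊂ ℙ⁵`, `W ⊂ ℂ⁶` of dimension `3`, that lie on the quadric `q = 0`. -/
def planesOn (q : Coord) : Set (Submodule ℂ (Fin 6 → ℂ)) :=
  {W | Module.finrank ℂ W = 3 ∧ ∀ x ∈ W, MvPolynomial.eval x q = 0}

/-- The homogeneous ideal of the linear subspace `ℙ(W) ⊂ ℙ⁵`. -/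
noncomputable def linearIdeal (W : Submodule ℂ (Fin 6 → ℂ)) : Ideal Coord :=
  MvPolynomial.vanishingIdeal ℂ (W : Set (Fin 6 → ℂ))

/-- `I` is the ideal of a plane cubic in `ℙ⁵` (possibly reducible or non-reduced): the divisor,
in some plane `ℙ(W)`, of a cubic form that does not vanish identically on that plane. -/
def IsPlaneCubic (I : Ideal Coord) : Prop :=
  ∃ W : Submodule ℂ (Fin 6 → ℂ), Module.finrank ℂ W = 3 ∧
    ∃ g : Coord, g.IsHomogeneous 3 ∧ g ∉ linearIdeal W ∧ I = linearIdeal W ⊔ Ideal.span {g}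

/-- `I` is the ideal of a smooth plane cubic curve in `ℙ⁵`. -/
def IsSmoothPlaneCubic (I : Ideal Coord) : Prop :=
  IsPlaneCubic I ∧ IsSmoothOfDim I 1

/-- The plane cubics that are contained, as schemes, in `V = {q = f = 0}`. -/
def planeCubicsOn (q f : Coord) : Set (Ideal Coord) :=
  {I | IsPlaneCubic I ∧ Ideal.span {q, f} ≤ I}

/-- The scheme-theoretic intersection of `V = {q = f = 0}` with the linear subspace `ℙ(W)`. -/
noncomputable def linearSection (q f : Coord) (W : Submodule ℂ (Fin 6 → ℂ)) : Ideal Coord :=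
  linearIdeal W ⊔ Ideal.span {q, f}

/-- `Λ` is a `ℙ³`-family of planes in `ℙ⁵`: a closed embedding of `ℙ³` into the Grassmannian
`G(3, ℂ⁶)`. In Plücker coordinates `Λ` is given by forms `p s` in four variables of one and the
same degree (the index `s` runs through the increasing triples of columns, and the linear
independence of `w` says that these forms have no common zero); `Λ` is injective, and its
differential is injective everywhere (by Euler's formula, this is the injectivity of the
differential of the map `t ↦ (p s (t))ₛ` of affine spaces at all `t ≠ 0`). -/
def IsP3Family (Λ : Projectivization ℂ (Fin 4 → ℂ) → Submodule ℂ (Fin 6 → ℂ)) : Prop :=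
  Function.Injective Λ ∧
  ∃ (d : ℕ) (p : (Fin 3 ↪o Fin 6) → MvPolynomial (Fin 4) ℂ),
    (∀ s, (p s).IsHomogeneous d) ∧
    (∀ (t : Fin 4 → ℂ) (ht : t ≠ 0), ∃ w : Fin 3 → Fin 6 → ℂ,
      LinearIndependent ℂ w ∧
      Submodule.span ℂ (Set.range w) = Λ (Projectivization.mk ℂ t ht) ∧
      ∀ s, (Matrix.of fun a b : Fin 3 => w a (s b)).det = MvPolynomial.eval t (p s)) ∧
    (∀ t : Fin 4 → ℂ, t ≠ 0 → ∀ v : Fin 4 → ℂ, (∀ s, differential (p s) t v = 0) → v = 0)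

/-- `P` holds at the general point of `ℙ³`: at all points of a non-empty Zariski open set
(which may be taken to be the complement of a hypersurface `h = 0`). -/
def ForGeneralPoint (P : Projectivization ℂ (Fin 4 → ℂ) → Prop) : Prop :=
  ∃ h : MvPolynomial (Fin 4) ℂ, h ≠ 0 ∧ (∃ d, h.IsHomogeneous d) ∧
    ∀ (t : Fin 4 → ℂ) (ht : t ≠ 0), MvPolynomial.eval t h ≠ 0 → P (Projectivization.mk ℂ t ht)

/-- `P` holds for the general smooth `V = {q = f = 0}` on the fixed quadric `q = 0`: there is a
polynomial `G` in the coefficients of the cubic form `f` such that `P f` holds whenever `V` is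
smooth and `G` does not vanish at `f`, and such `f` exist. -/
def ForGeneralV6 (q : Coord) (P : Coord → Prop) : Prop :=
  ∃ G : MvPolynomial (Fin 6 →₀ ℕ) ℂ,
    (∃ f, IsV6 q f ∧ MvPolynomial.eval (fun m => MvPolynomial.coeff m f) G ≠ 0) ∧
    ∀ f, IsV6 q f → MvPolynomial.eval (fun m => MvPolynomial.coeff m f) G ≠ 0 → P f

end FanoGenusFour

open FanoGenusFour

/-! Over `ℂ` a quadric of rank 6 becomes `u ⬝ v` on `ℂ³ ⊕ ℂ³`, and one of rank 5 becomes the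
pullback of this form under `coneProj`, a cone over the hyperplane section `y₅ = y₂`. A totally
isotropic 3-space meeting `u = 0` trivially is the graph of a skew map `u ↦ τ × u`; closing up in
`[t₀ : τ]` gives the planes `kleinPlane t`, and exchanging `u` and `v` gives the second family.
`exists_le_kleinPlane_or_dual` shows that there are no others. In rank 5 a plane passes through the
vertex and projects to a line of the quadric threefold; that line lies in some `kleinPlane t`, and
the plane is the preimage `conePlane t`.

The Plücker coordinates of these families are quadrics in `t` that span all quadrics. Such a family
is the Veronese embedding of `ℙ³` followed by an injective linear map, hence a closed embedding
(`IsVeroneseFamily.isP3Family`).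

If a plane cubic lies on `V`, degree reasons force `q` to vanish on its plane and `f` to restrict
there to a multiple of the cubic. So plane cubics are the sections by planes of `Q`, provided `V`
contains no plane (`IsV6.notMem_linearIdeal`). On a plane inside `V` the normal derivatives of `q`
and `f` would form a `2 × 3` matrix of linear and quadratic forms, which drops rank somewhere
(`exists_dependent_rows`), and `V` would be singular there.

For the general statements, `macaulayMinor` is a polynomial in the coefficients of a ternary cubic
whose nonvanishing implies smoothness. It is nonzero on the Fermat cubic, and in normal coordinates
the six-variable Fermat cubic gives a smooth `V` and restricts to the ternary Fermat cubic on a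
plane of each family. Nonvanishing is open both in `f` and in `t`. -/

namespace FanoGenusFour

open MvPolynomial

/-! ### Differentials of polynomials. -/

section Differential

variable {m n : ℕ}

theorem differential_apply (p : MvPolynomial (Fin n) ℂ) (x v : Fin n → ℂ) :
    differential p x v = ∑ i, eval x (pderiv i p) * v i := by
  simp [differential, LinearMap.sum_apply]

@[simp] theorem differential_C (c : ℂ) (x : Fin n → ℂ) :
    differential (C c) x = 0 := by
  ext v; simp [differential_apply]

@[simp] theorem differential_zero (x : Fin n → ℂ) :
    differential (0 : MvPolynomial (Fin n) ℂ) x = 0 := by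
  ext v; simp [differential_apply]

theorem differential_X (i : Fin n) (x v : Fin n → ℂ) :
    differential (X i) x v = v i := by
  simp [differential_apply, pderiv_X, Pi.single_apply, apply_ite]

@[simp] theorem differential_add (p q : MvPolynomial (Fin n) ℂ) (x : Fin n → ℂ) :
    differential (p + q) x = differential p x + differential q x := by
  refine LinearMap.ext fun v => ?_
  simp [differential_apply, add_mul, Finset.sum_add_distrib]

@[simp] theorem differential_mul (p q : MvPolynomial (Fin n) ℂ) (x : Fin n → ℂ) :
    differential (p * q) x = eval x p • differential q x + eval x q • differential p x := by
  refine LinearMap.ext fun v => ?_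
  simp only [differential_apply, LinearMap.add_apply, LinearMap.smul_apply, smul_eq_mul,
    Finset.mul_sum, ← Finset.sum_add_distrib]
  refine Finset.sum_congr rfl fun i _ => ?_
  simp
  ring

theorem differential_smul (c : ℂ) (p : MvPolynomial (Fin n) ℂ) (x : Fin n → ℂ) :
    differential (c • p) x = c • differential p x := by
  simp [smul_eq_C_mul]

end Differential

/-! ### Restriction of polynomials to parametrized linear subspaces. -/

section Restrict

variable {R S : Type*} [CommRing R] [CommRing S] {l m n : ℕ}

/-- The polynomial `p` in the coordinates `y` of the point `∑ a, y a • w a`. -/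
noncomputable def restrict (w : Fin m → Fin n → R) :
    MvPolynomial (Fin n) R →ₐ[R] MvPolynomial (Fin m) R :=
  aeval fun i => ∑ a, C (w a i) * X a

@[simp] theorem restrict_X (w : Fin m → Fin n → R) (i : Fin n) :
    restrict w (X i) = ∑ a, C (w a i) * X a := by
  simp [restrict]

theorem eval_restrict (w : Fin m → Fin n → R) (y : Fin m → R) (p : MvPolynomial (Fin n) R) :
    eval y (restrict w p) = eval (Fintype.linearCombination R w y) p := by
  induction p using MvPolynomial.induction_on with
  | C a => simp [restrict]
  | add p q hp hq => simp [hp, hq]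
  | mul_X p i hp =>
    simp [hp, Fintype.linearCombination_apply, mul_comm]

theorem restrict_isHomogeneous (w : Fin m → Fin n → R) {p : MvPolynomial (Fin n) R} {d : ℕ}
    (hp : p.IsHomogeneous d) : (restrict w p).IsHomogeneous d := by
  have := hp.aeval (fun i => ∑ a, C (w a i) * X a) (n := 1)
    fun i => IsHomogeneous.sum _ _ _ fun a _ => isHomogeneous_C_mul_X _ _
  simpa [restrict] using this

theorem map_restrict (φ : R →+* S) (w : Fin m → Fin n → R) (p : MvPolynomial (Fin n) R) :
    map φ (restrict w p) = restrict (fun a i => φ (w a i)) (map φ p) := by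
  induction p using MvPolynomial.induction_on with
  | C a => simp [restrict]
  | add p q hp hq => simp [hp, hq]
  | mul_X p i hp => simp [hp]

theorem differential_restrict (w : Fin m → Fin n → ℂ) (p : MvPolynomial (Fin n) ℂ)
    (y : Fin m → ℂ) :
    differential (restrict w p) y =
      differential p (Fintype.linearCombination ℂ w y) ∘ₗ Fintype.linearCombination ℂ w := by
  induction p using MvPolynomial.induction_on with
  | C a => simp [restrict]
  | add p q hp hq => simp [hp, hq, LinearMap.add_comp]
  | mul_X p i hp =>
    have hX : differential (restrict w (X i)) y =
        differential (X i) (Fintype.linearCombination ℂ w y) ∘ₗ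
          Fintype.linearCombination ℂ w := by
      refine LinearMap.ext fun v => ?_
      rw [LinearMap.comp_apply, differential_X, restrict_X, differential_apply]
      simp [pderiv_X, Pi.single_apply, Fintype.linearCombination_apply, apply_ite, mul_comm]
    rw [map_mul, differential_mul, differential_mul, hp, hX, eval_restrict, eval_restrict]
    ext v
    simp

end Restrict

/-! ### Ideals of linear subspaces. -/

section LinearIdeal

variable {W : Submodule ℂ (Fin 6 → ℂ)}

theorem mem_linearIdeal {p : Coord} : p ∈ linearIdeal W ↔ ∀ x ∈ W, eval x p = 0 := by
  simp [linearIdeal, mem_vanishingIdeal_iff, aeval_eq_eval]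

theorem mem_span_range_iff_linearCombination {m n : ℕ} {w : Fin m → Fin n → ℂ} {x : Fin n → ℂ} :
    x ∈ Submodule.span ℂ (Set.range w) ↔ ∃ y, Fintype.linearCombination ℂ w y = x := by
  rw [← Fintype.range_linearCombination, LinearMap.mem_range]

theorem mem_linearIdeal_span_iff {m : ℕ} {w : Fin m → Fin 6 → ℂ} {p : Coord} :
    p ∈ linearIdeal (Submodule.span ℂ (Set.range w)) ↔ restrict w p = 0 := by
  rw [mem_linearIdeal]
  constructor
  · intro h
    refine MvPolynomial.funext fun y => ?_
    rw [eval_restrict, map_zero]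
    exact h _ (mem_span_range_iff_linearCombination.2 ⟨y, rfl⟩)
  · intro h x hx
    obtain ⟨y, rfl⟩ := mem_span_range_iff_linearCombination.1 hx
    rw [← eval_restrict, h, map_zero]

/-- The linear form with the same values as a linear functional. -/
noncomputable def linearForm {n : ℕ} (l : (Fin n → ℂ) →ₗ[ℂ] ℂ) : MvPolynomial (Fin n) ℂ :=
  ∑ i, C (l (Pi.single i 1)) * X i

theorem eval_linearForm {n : ℕ} (l : (Fin n → ℂ) →ₗ[ℂ] ℂ) (x : Fin n → ℂ) :
    eval x (linearForm l) = l x := by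
  rw [LinearMap.pi_apply_eq_sum_univ l x]
  simp [linearForm, mul_comm, ← Pi.single_apply]
  refine Finset.sum_congr rfl fun i _ => ?_
  congr 2
  ext j
  simp [Pi.single_apply, eq_comm]

theorem differential_linearForm {n : ℕ} (l : (Fin n → ℂ) →ₗ[ℂ] ℂ) (x v : Fin n → ℂ) :
    differential (linearForm l) x v = l v := by
  rw [← eval_linearForm l v, differential_apply]
  simp [linearForm, pderiv_X, Pi.single_apply, apply_ite]

theorem linearForm_isHomogeneous {n : ℕ} (l : (Fin n → ℂ) →ₗ[ℂ] ℂ) :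
    (linearForm l).IsHomogeneous 1 :=
  IsHomogeneous.sum _ _ _ fun _ _ => isHomogeneous_C_mul_X _ _

/-- The polynomial restricts to zero on the span of `x` and `v`; the chain rule at `![1, 0]` in the
direction `![0, 1]` reads off the derivative. Independence of `x` and `v` is not needed. -/
theorem differential_eq_zero_of_mem_linearIdeal {p : Coord} (hp : p ∈ linearIdeal W)
    {x v : Fin 6 → ℂ} (hx : x ∈ W) (hv : v ∈ W) : differential p x v = 0 := by
  have h : restrict ![x, v] p = 0 := by
    rw [← mem_linearIdeal_span_iff, mem_linearIdeal]
    intro z hz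
    refine mem_linearIdeal.1 hp z (Submodule.span_le.2 ?_ hz)
    rintro _ ⟨a, rfl⟩
    fin_cases a <;> simpa
  have := LinearMap.congr_fun (differential_restrict ![x, v] p ![1, 0]) ![0, 1]
  simpa [h, Fintype.linearCombination_apply, Fin.sum_univ_two] using this.symm

end LinearIdeal

/-! ### Degeneracy of a `2 × 3` matrix of forms on the projective plane, by Hilbert functions. -/

section Determinantal

theorem finrank_homogeneousSubmodule_fin_three (n : ℕ) :
    Module.finrank ℂ (homogeneousSubmodule (Fin 3) ℂ n) = (n + 2).choose 2 := by
  have h : {d : Fin 3 →₀ ℕ | d.degree = n} =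
      ((Finset.univ : Finset (Fin 3)).finsuppAntidiag n : Set (Fin 3 →₀ ℕ)) := by
    ext d
    simp [Finset.mem_finsuppAntidiag, Finsupp.degree_eq_sum]
  rw [homogeneousSubmodule_eq_finsupp_supported, h,
    (AddMonoidAlgebra.supportedEquivFinsupp _).finrank_eq, Module.finrank_finsupp_self,
    ← Nat.card_eq_fintype_card, SetLike.coe_sort_coe, Nat.card_eq_fintype_card, Fintype.card_coe,
    Finset.card_finsuppAntidiag_nat_eq_choose]
  simp only [Finset.card_univ, Fintype.card_fin]
  rw [show 3 + n - 1 = n + 2 by omega, ← Nat.choose_symm_add]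

instance finite_homogeneousSubmodule (n : ℕ) :
    Module.Finite ℂ (homogeneousSubmodule (Fin 3) ℂ n) :=
  Module.Finite.iff_fg.2 (homogeneousSubmodule_fg _ _ n)

/-- Multiplication by a form as a map between homogeneous components. -/
noncomputable def mulForm {σ : Type*} {a : MvPolynomial σ ℂ} {d : ℕ} (ha : a.IsHomogeneous d)
    (m : ℕ) {n : ℕ} (h : m + d = n) :
    homogeneousSubmodule σ ℂ m →ₗ[ℂ] homogeneousSubmodule σ ℂ n :=
  ((LinearMap.mulRight ℂ a).domRestrict _).codRestrict _ fun p => h ▸ IsHomogeneous.mul p.2 ha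

@[simp] theorem coe_mulForm {σ : Type*} {a : MvPolynomial σ ℂ} {d : ℕ} (ha : a.IsHomogeneous d)
    (m : ℕ) {n : ℕ} (h : m + d = n) (p : homogeneousSubmodule σ ℂ m) :
    (mulForm ha m h p : MvPolynomial σ ℂ) = p * a := rfl

/-- This allows the coefficients to be taken homogeneous when a form is written as a combination of
homogeneous generators. -/
theorem homogeneousComponent_mul_of_isHomogeneous {σ : Type*} (p : MvPolynomial σ ℂ)
    {a : MvPolynomial σ ℂ} {d : ℕ} (ha : a.IsHomogeneous d) (m : ℕ) :
    homogeneousComponent (m + d) (p * a) = homogeneousComponent m p * a := by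
  conv_lhs => rw [← sum_homogeneousComponent p]
  rw [Finset.sum_mul, map_sum]
  have h : ∀ i, homogeneousComponent (m + d) (homogeneousComponent i p * a) =
      if i = m then homogeneousComponent m p * a else 0 := by
    intro i
    rw [homogeneousComponent_of_mem ((homogeneousComponent_isHomogeneous i p).mul ha)]
    by_cases hi : i = m
    · simp [hi]
    · rw [if_neg (by omega), if_neg hi]
  simp only [h, Finset.sum_ite_eq', Finset.mem_range]
  split_ifs with hm
  · rfl
  · rw [homogeneousComponent_eq_zero _ _ (by omega), zero_mul]

/-- Every form of large degree lies in an ideal whose only zero is the origin. -/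
theorem exists_forall_isHomogeneous_mem {n : ℕ} (I : Ideal (MvPolynomial (Fin n) ℂ))
    (hI : ∀ x : Fin n → ℂ, (∀ p ∈ I, eval x p = 0) → x = 0) :
    ∃ N : ℕ, ∀ m ≥ N, ∀ p : MvPolynomial (Fin n) ℂ, p.IsHomogeneous m → p ∈ I := by
  -- Nullstellensatz: each variable has a power `X i ^ k i` in `I`.
  have hX : ∀ i : Fin n, X i ∈ I.radical := by
    intro i
    rw [← vanishingIdeal_zeroLocus_eq_radical (K := ℂ), mem_vanishingIdeal_iff]
    intro x hx
    have := hI x fun p hp => by simpa [aeval_eq_eval] using mem_zeroLocus_iff.1 hx p hp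
    simp [this]
  choose k hk using hX
  -- A monomial of degree above `∑ k i` has, by pigeonhole, some exponent at least `k i`.
  refine ⟨∑ i, k i + 1, fun m hm p hp => ?_⟩
  rw [p.as_sum]
  refine Ideal.sum_mem _ fun d hd => ?_
  have hdeg : ∑ i, d i = m := by
    rw [← Finsupp.degree_eq_sum]
    by_contra h
    exact (mem_support_iff.1 hd) (hp.coeff_eq_zero h)
  obtain ⟨i, hi⟩ : ∃ i, k i ≤ d i := by
    by_contra! h
    have := Finset.sum_le_sum fun i (_ : i ∈ Finset.univ) => (h i).le
    omega
  have : monomial d (coeff d p) =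
      monomial (d - Finsupp.single i (k i)) (coeff d p) * X i ^ k i := by
    rw [X_pow_eq_monomial, monomial_mul, mul_one, tsub_add_cancel_of_le]
    simpa using hi
  rw [this]
  exact I.mul_mem_left _ (hk i)

/-- A `2 × 3` matrix with a row of linear forms and a row of quadratic forms in three variables
has rank at most one at some point of the projective plane. -/
theorem exists_dependent_rows (l g : Fin 3 → MvPolynomial (Fin 3) ℂ)
    (hl : ∀ i, (l i).IsHomogeneous 1) (hg : ∀ i, (g i).IsHomogeneous 2) :
    ∃ y : Fin 3 → ℂ, y ≠ 0 ∧ ∀ i j, eval y (l i) * eval y (g j) = eval y (l j) * eval y (g i) := by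
  by_contra! H
  -- The maximal minors, with indices cyclic in `Fin 3`. If the rank never drops, they have no
  -- common zero but the origin; a dimension count along the Hilbert–Burch complex refutes this.
  set M : Fin 3 → MvPolynomial (Fin 3) ℂ :=
    fun k => l (k + 1) * g (k + 2) - l (k + 2) * g (k + 1) with hM
  have hMhom : ∀ k, (M k).IsHomogeneous 3 := fun k => ((hl _).mul (hg _)).sub ((hl _).mul (hg _))
  obtain ⟨N, hN⟩ := exists_forall_isHomogeneous_mem (Ideal.span (Set.range M)) fun x hx => by
    by_contra hx0
    obtain ⟨i, j, hij⟩ := H x hx0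
    have h : ∀ k, eval x (l (k + 1)) * eval x (g (k + 2)) =
        eval x (l (k + 2)) * eval x (g (k + 1)) := fun k => by
      have := hx (M k) (Ideal.subset_span ⟨k, rfl⟩)
      simpa [hM, sub_eq_zero] using this
    have h0 := h 0
    have h1 := h 1
    have h2 := h 2
    simp only [Fin.isValue, show (1 : Fin 3) + 1 = 2 from rfl, show (1 : Fin 3) + 2 = 0 from rfl,
      show (2 : Fin 3) + 1 = 0 from rfl, show (2 : Fin 3) + 2 = 1 from rfl, zero_add] at h0 h1 h2
    fin_cases i <;> fin_cases j <;> simp_all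
  obtain ⟨i, j, hij⟩ := H 1 one_ne_zero
  have hminor : l i * g j - l j * g i ≠ 0 := fun h => hij <| by
    simpa [sub_eq_zero] using congrArg (eval 1) h
  set n := N + 5 with hn
  let Φ : (Fin 3 → homogeneousSubmodule (Fin 3) ℂ (N + 2)) →ₗ[ℂ] homogeneousSubmodule (Fin 3) ℂ n :=
    ∑ k, mulForm (hMhom k) (N + 2) (by omega) ∘ₗ LinearMap.proj k
  -- Each row of the matrix is a syzygy of the minors, so the image of `Ψ` lies in the kernel of
  -- `Φ`.
  let Ψ : (homogeneousSubmodule (Fin 3) ℂ (N + 1) × homogeneousSubmodule (Fin 3) ℂ N) →ₗ[ℂ]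
      (Fin 3 → homogeneousSubmodule (Fin 3) ℂ (N + 2)) :=
    LinearMap.pi fun k => (mulForm (hl k) (N + 1) (by omega)).coprod (mulForm (hg k) N (by omega))
  have hΦval : ∀ c, (Φ c : MvPolynomial (Fin 3) ℂ) =
      ∑ k, (c k : MvPolynomial (Fin 3) ℂ) * M k := fun c => by
    simp [Φ, LinearMap.sum_apply]
  have hΨval : ∀ p k, (Ψ p k : MvPolynomial (Fin 3) ℂ) = p.1 * l k + p.2 * g k := fun p k => rfl
  have hΦ : Function.Surjective Φ := by
    rintro ⟨p, hp⟩
    have hpI : p ∈ Ideal.span (Set.range M) := hN n (by omega) p hp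
    obtain ⟨c, hc⟩ := Ideal.mem_span_range_iff_exists_fun.1 hpI
    refine ⟨fun k => ⟨homogeneousComponent (N + 2) (c k), homogeneousComponent_isHomogeneous _ _⟩,
      Subtype.ext ?_⟩
    have h1 : homogeneousComponent n p = p := homogeneousComponent_eq_self hp
    rw [hΦval]
    refine Eq.trans ?_ h1
    rw [← hc, map_sum]
    exact Finset.sum_congr rfl fun k _ =>
      (homogeneousComponent_mul_of_isHomogeneous (c k) (hMhom k) (N + 2)).symm
  have hΨ : Function.Injective Ψ := by
    rw [← LinearMap.ker_eq_bot, LinearMap.ker_eq_bot']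
    rintro ⟨p, r⟩ h
    have hk : ∀ k, (p : MvPolynomial (Fin 3) ℂ) * l k + r * g k = 0 := fun k => by
      simpa [hΨval] using congrArg Subtype.val (congrFun h k)
    have hr : (r : MvPolynomial (Fin 3) ℂ) = 0 := by
      have : (r : MvPolynomial (Fin 3) ℂ) * (l i * g j - l j * g i) = 0 := by
        linear_combination l i * hk j - l j * hk i
      exact (mul_eq_zero.1 this).resolve_right hminor
    have hp : (p : MvPolynomial (Fin 3) ℂ) = 0 := by
      have : (p : MvPolynomial (Fin 3) ℂ) * (l i * g j - l j * g i) = 0 := by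
        linear_combination g j * hk i - g i * hk j
      exact (mul_eq_zero.1 this).resolve_right hminor
    ext1
    · exact Subtype.ext hp
    · exact Subtype.ext hr
  have hΨΦ : LinearMap.range Ψ ≤ LinearMap.ker Φ := by
    rintro _ ⟨⟨p, r⟩, rfl⟩
    rw [LinearMap.mem_ker]
    refine Subtype.ext ?_
    simp only [hΦval, hΨval, hM, Fin.sum_univ_three, Submodule.coe_zero]
    simp only [Fin.isValue, show (1 : Fin 3) + 1 = 2 from rfl, show (1 : Fin 3) + 2 = 0 from rfl,
      show (2 : Fin 3) + 1 = 0 from rfl, show (2 : Fin 3) + 2 = 1 from rfl, zero_add]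
    ring
  have h1 := LinearMap.finrank_range_add_finrank_ker Φ
  rw [LinearMap.range_eq_top.2 hΦ, finrank_top] at h1
  have h2 := Submodule.finrank_mono hΨΦ
  rw [LinearMap.finrank_range_of_inj hΨ] at h2
  simp only [Module.finrank_prod, Module.finrank_pi_fintype, Finset.sum_const, Finset.card_univ,
    Fintype.card_fin, finrank_homogeneousSubmodule_fin_three, smul_eq_mul, hn] at h1 h2
  have hch : ∀ k : ℕ, ((k + 2).choose 2 : ℚ) = (k + 2) * (k + 1) / 2 := fun k => by
    rw [Nat.cast_choose_two]
    push_cast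
    ring
  -- The left side exceeds the right by exactly 7 for every `N`; this is the expected number `1² +
  -- 1·2 + 2²` of degeneracy points.
  have h3 : ((N + 5 + 2).choose 2 : ℚ) + ((N + 1 + 2).choose 2 + (N + 2).choose 2) ≤
      3 * (N + 2 + 2).choose 2 := by
    exact_mod_cast h1 ▸ Nat.add_le_add_left h2 _
  simp only [hch] at h3
  push_cast at h3
  nlinarith

end Determinantal

/-! ### Tangent spaces of `V`, and why `V` contains no plane. -/

section TangentSpace

theorem mem_tangentSpace {I : Ideal Coord} {x v : Fin 6 → ℂ} :
    v ∈ tangentSpace I x ↔ ∀ p ∈ I, differential p x v = 0 := by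
  simp [tangentSpace]

theorem mem_tangentSpace_span {S : Set Coord} {x v : Fin 6 → ℂ} (hS : ∀ p ∈ S, eval x p = 0) :
    v ∈ tangentSpace (Ideal.span S) x ↔ ∀ p ∈ S, differential p x v = 0 := by
  rw [mem_tangentSpace]
  refine ⟨fun h p hp => h p (Ideal.subset_span hp), fun h p hp => ?_⟩
  have hle : Ideal.span S ≤ RingHom.ker (eval x) := Ideal.span_le.2 hS
  induction hp using Submodule.span_induction with
  | mem p hp => exact h p hp
  | zero => simp
  | add p q _ _ hp hq => simp [hp, hq]
  | smul a p hpS hp =>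
    have : eval x p = 0 := hle hpS
    simp [hp, this]

theorem tangentSpace_span_pair {q f : Coord} {x : Fin 6 → ℂ} (hq : eval x q = 0)
    (hf : eval x f = 0) : tangentSpace (Ideal.span {q, f}) x =
      LinearMap.ker (differential q x) ⊓ LinearMap.ker (differential f x) := by
  ext v
  rw [mem_tangentSpace_span (by rintro p (rfl | rfl) <;> assumption)]
  simp

theorem five_le_finrank_ker (l : (Fin 6 → ℂ) →ₗ[ℂ] ℂ) :
    5 ≤ Module.finrank ℂ (LinearMap.ker l) := by
  have h1 := LinearMap.finrank_range_add_finrank_ker l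
  have h2 := Submodule.finrank_le (LinearMap.range l)
  simp only [Module.finrank_self, Module.finrank_fin_fun] at h1 h2
  omega

theorem exists_frame {W : Submodule ℂ (Fin 6 → ℂ)} {d : ℕ} (hW : Module.finrank ℂ W = d) :
    ∃ w : Fin d → Fin 6 → ℂ, LinearIndependent ℂ w ∧ Submodule.span ℂ (Set.range w) = W := by
  let b := Module.finBasisOfFinrankEq ℂ W hW
  refine ⟨fun i => b i, b.linearIndependent.map' W.subtype (Submodule.ker_subtype W), ?_⟩
  have := congrArg (Submodule.map W.subtype) b.span_eq
  rwa [Submodule.map_span, ← Set.range_comp, Submodule.map_subtype_top] at this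

theorem linearCombination_ne_zero {m n : ℕ} {w : Fin m → Fin n → ℂ} (hw : LinearIndependent ℂ w)
    {y : Fin m → ℂ} (hy : y ≠ 0) : Fintype.linearCombination ℂ w y ≠ 0 := fun h =>
  hy ((map_eq_zero_iff _ hw.fintypeLinearCombination_injective).1 h)

/-- A smooth complete intersection of a quadric and a cubic contains no plane. -/
theorem IsV6.notMem_linearIdeal {q f : Coord} (hV : IsV6 q f) {W : Submodule ℂ (Fin 6 → ℂ)}
    (hW : W ∈ planesOn q) : f ∉ linearIdeal W := by
  intro hf
  obtain ⟨hq2, hf3, hsm⟩ := hV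
  have hq : q ∈ linearIdeal W := mem_linearIdeal.2 hW.2
  obtain ⟨w, hw, rfl⟩ := exists_frame hW.1
  set W := Submodule.span ℂ (Set.range w) with hWdef
  obtain ⟨W', hW'⟩ := W.exists_isCompl
  have hW'3 : Module.finrank ℂ W' = 3 := by
    have := Submodule.finrank_add_eq_of_isCompl hW'
    rw [hW.1, Module.finrank_fin_fun] at this
    omega
  obtain ⟨c, -, hc⟩ := exists_frame hW'3
  -- The derivative in the `i`-th direction normal to the plane, as a form on the plane: linear for
  -- `q`, quadratic for `f`.
  let row (p : Coord) (i : Fin 3) : MvPolynomial (Fin 3) ℂ :=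
    ∑ k, restrict w (pderiv k p) * C (c i k)
  have hrow : ∀ p i y, eval y (row p i) =
      differential p (Fintype.linearCombination ℂ w y) (c i) := fun p i y => by
    simp [row, eval_restrict, differential_apply]
  have hrowhom : ∀ p d i, p.IsHomogeneous (d + 1) → (row p i).IsHomogeneous d := fun p d i hp =>
    IsHomogeneous.sum _ _ _ fun k _ => by
      simpa using (restrict_isHomogeneous w (hp.pderiv (i := k))).mul (isHomogeneous_C _ (c i k))
  obtain ⟨y, hy, hdep⟩ := exists_dependent_rows (row q) (row f) (fun i => hrowhom q 1 i hq2)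
    (fun i => hrowhom f 2 i hf3)
  simp only [hrow] at hdep
  set x := Fintype.linearCombination ℂ w y with hx
  have hxW : x ∈ W := mem_span_range_iff_linearCombination.2 ⟨y, rfl⟩
  have hx0 : x ≠ 0 := linearCombination_ne_zero hw hy
  have hqx := mem_linearIdeal.1 hq x hxW
  have hfx := mem_linearIdeal.1 hf x hxW
  have hext : ∀ l : (Fin 6 → ℂ) →ₗ[ℂ] ℂ, (∀ v ∈ W, l v = 0) → (∀ i, l (c i) = 0) → l = 0 := by
    intro l hlW hlc
    have h1 : W ≤ LinearMap.ker l := fun v hv => hlW v hv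
    have h2 : W' ≤ LinearMap.ker l := by
      rw [← hc, Submodule.span_le]
      rintro _ ⟨i, rfl⟩
      exact hlc i
    rw [← LinearMap.ker_eq_top, ← top_le_iff, ← hW'.sup_eq_top]
    exact sup_le h1 h2
  have hfin := hsm x hx0 fun p hp => by
    have hle : Ideal.span {q, f} ≤ RingHom.ker (eval x) :=
      Ideal.span_le.2 (by rintro p (rfl | rfl) <;> assumption)
    exact hle hp
  rw [tangentSpace_span_pair hqx hfx] at hfin
  -- Derivatives along `W` vanish, so dependence of the normal rows makes the two differentials
  -- dependent. The tangent space of the cone then has dimension at least 5 instead of 4.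
  by_cases hl : ∀ i, differential q x (c i) = 0
  · have : differential q x = 0 :=
      hext _ (fun v hv => differential_eq_zero_of_mem_linearIdeal hq hxW hv) hl
    rw [this, LinearMap.ker_zero, top_inf_eq] at hfin
    have := five_le_finrank_ker (differential f x)
    omega
  · push Not at hl
    obtain ⟨i, hi⟩ := hl
    have h0 := hext (differential f x (c i) • differential q x -
        differential q x (c i) • differential f x)
      (fun v hv => by
        simp [differential_eq_zero_of_mem_linearIdeal hq hxW hv,
          differential_eq_zero_of_mem_linearIdeal hf hxW hv])
      (fun j => by
        simp only [LinearMap.sub_apply, LinearMap.smul_apply, smul_eq_mul]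
        linear_combination -hdep i j)
    have hle : LinearMap.ker (differential q x) ≤ LinearMap.ker (differential f x) := by
      intro v hv
      have := LinearMap.congr_fun h0 v
      rw [LinearMap.mem_ker] at hv ⊢
      simpa [hv, hi] using this
    rw [inf_eq_left.2 hle] at hfin
    have := five_le_finrank_ker (differential q x)
    omega

end TangentSpace

/-! ### Plane cubics on `V` as sections by planes of `Q`. -/

section PlaneCubics

variable {q f : Coord} {W W' : Submodule ℂ (Fin 6 → ℂ)}

theorem restrict_mem_of_mem_sup {m : ℕ} {w : Fin m → Fin 6 → ℂ} {g p : Coord}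
    (hp : p ∈ linearIdeal (Submodule.span ℂ (Set.range w)) ⊔ Ideal.span {g}) :
    ∃ h, restrict w p = h * restrict w g := by
  obtain ⟨a, ha, b, hb, rfl⟩ := Submodule.mem_sup.1 hp
  obtain ⟨h, rfl⟩ := Ideal.mem_span_singleton'.1 hb
  exact ⟨restrict w h, by rw [map_add, mem_linearIdeal_span_iff.1 ha, zero_add, map_mul]⟩

/-- On the plane `p` is a multiple of `g`, a form of larger degree, so it vanishes there. -/
theorem mem_linearIdeal_of_mem_sup (hW : Module.finrank ℂ W = 3) {g p : Coord} {d e : ℕ}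
    (hg : g.IsHomogeneous d) (hp : p.IsHomogeneous e) (hed : e < d)
    (h : p ∈ linearIdeal W ⊔ Ideal.span {g}) : p ∈ linearIdeal W := by
  obtain ⟨w, hw, rfl⟩ := exists_frame hW
  obtain ⟨k, hk⟩ := restrict_mem_of_mem_sup h
  rw [mem_linearIdeal_span_iff]
  by_contra hne
  have hkg := hk ▸ hne
  have h1 := (restrict_isHomogeneous w hp).totalDegree hne
  rw [hk, totalDegree_mul_of_isDomain (left_ne_zero_of_mul hkg) (right_ne_zero_of_mul hkg),
    (restrict_isHomogeneous w hg).totalDegree (right_ne_zero_of_mul hkg)] at h1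
  omega

theorem linearSection_eq (hW : W ∈ planesOn q) :
    linearSection q f W = linearIdeal W ⊔ Ideal.span {f} := by
  have hq : Ideal.span {q} ≤ linearIdeal W :=
    (Ideal.span_singleton_le_iff_mem _).2 (mem_linearIdeal.2 hW.2)
  rw [linearSection, Ideal.span_insert, ← sup_assoc, sup_eq_left.2 hq]

theorem IsV6.isPlaneCubic_linearSection (hV : IsV6 q f) (hW : W ∈ planesOn q) :
    IsPlaneCubic (linearSection q f W) :=
  ⟨W, hW.1, f, hV.2.1, hV.notMem_linearIdeal hW, linearSection_eq hW⟩

theorem IsV6.planeCubicsOn_eq (hV : IsV6 q f) :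
    planeCubicsOn q f = linearSection q f '' planesOn q := by
  ext I
  constructor
  · rintro ⟨⟨W, hW3, g, hg3, hgW, rfl⟩, hI⟩
    have hqI : q ∈ linearIdeal W ⊔ Ideal.span {g} := hI (Ideal.subset_span (by simp))
    have hfI : f ∈ linearIdeal W ⊔ Ideal.span {g} := hI (Ideal.subset_span (by simp))
    have hW : W ∈ planesOn q :=
      ⟨hW3, mem_linearIdeal.1 (mem_linearIdeal_of_mem_sup hW3 hg3 hV.1 (by norm_num) hqI)⟩
    refine ⟨W, hW, ?_⟩
    rw [linearSection_eq hW]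
    refine le_antisymm (sup_le le_sup_left ((Ideal.span_singleton_le_iff_mem _).2 hfI))
      (sup_le le_sup_left ((Ideal.span_singleton_le_iff_mem _).2 ?_))
    have hfW := hV.notMem_linearIdeal hW
    obtain ⟨w, hw, rfl⟩ := exists_frame hW3
    obtain ⟨k, hk⟩ := restrict_mem_of_mem_sup hfI
    rw [mem_linearIdeal_span_iff] at hfW
    have hkg := hk ▸ hfW
    have h1 := (restrict_isHomogeneous w hV.2.1).totalDegree hfW
    rw [hk, totalDegree_mul_of_isDomain (left_ne_zero_of_mul hkg) (right_ne_zero_of_mul hkg),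
      (restrict_isHomogeneous w hg3).totalDegree (right_ne_zero_of_mul hkg)] at h1
    -- The restrictions of `f` and `g` have the same degree 3, so the quotient is a constant; it is
    -- nonzero because `V` does not contain the plane.
    obtain ⟨c, rfl⟩ : ∃ c, k = C c :=
      ⟨_, totalDegree_eq_zero_iff_eq_C.1 (by omega)⟩
    have hc : c ≠ 0 := by
      rintro rfl
      simp at hkg
    have hmem : g - C c⁻¹ * f ∈ linearIdeal (Submodule.span ℂ (Set.range w)) := by
      rw [mem_linearIdeal_span_iff, map_sub, map_mul, hk, sub_eq_zero, ← mul_assoc]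
      simp [restrict, ← C_mul, inv_mul_cancel₀ hc]
    exact Submodule.mem_sup.2 ⟨_, hmem, C c⁻¹ * f,
      Ideal.mul_mem_left _ _ (Ideal.mem_span_singleton_self f), by ring⟩
  · rintro ⟨W, hW, rfl⟩
    exact ⟨hV.isPlaneCubic_linearSection hW, le_sup_right⟩

/-- The plane is recovered from the section: since `f` has degree 3, the linear forms in the ideal
of the section are exactly those vanishing on the plane. -/
theorem linearSection_le_iff (hf : f.IsHomogeneous 3) (hW : W ∈ planesOn q)
    (hW' : W' ∈ planesOn q) (h : linearSection q f W ≤ linearSection q f W') : W' ≤ W := by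
  rw [linearSection_eq hW, linearSection_eq hW'] at h
  intro x hx
  by_contra hxW
  obtain ⟨l, hlx, hl⟩ := Submodule.exists_dual_map_eq_bot_of_notMem hxW inferInstance
  have hlW : ∀ z ∈ W, l z = 0 := fun z hz => by
    have : l z ∈ W.map l := ⟨z, hz, rfl⟩
    simpa [hl] using this
  have hlI : linearForm l ∈ linearIdeal W :=
    mem_linearIdeal.2 fun z hz => by rw [eval_linearForm, hlW z hz]
  have := mem_linearIdeal_of_mem_sup hW'.1 hf (linearForm_isHomogeneous l) (by norm_num)
    (h (Ideal.mem_sup_left hlI))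
  have := mem_linearIdeal.1 this x hx
  rw [eval_linearForm] at this
  exact hlx this

theorem injOn_linearSection (hf : f.IsHomogeneous 3) :
    Set.InjOn (linearSection q f) (planesOn q) := fun _ hW _ hW' h =>
  le_antisymm (linearSection_le_iff hf hW' hW h.ge) (linearSection_le_iff hf hW hW' h.le)

end PlaneCubics

/-! ### A smoothness criterion for ternary cubics that is polynomial in the coefficients. -/

section Discriminant

variable {R S : Type*} [CommRing R] [CommRing S]

/-- The exponents of the quartic monomials in three variables. -/
abbrev QuarticExponent : Type := (Finset.univ : Finset (Fin 3)).finsuppAntidiag 4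

/-- Degree 4 is the smallest in which pigeonhole works: three exponents at most 1 add up to at most
3. -/
theorem QuarticExponent.exists_two_le (m : QuarticExponent) : ∃ i, 2 ≤ m.1 i := by
  by_contra! h
  have h4 := (Finset.mem_finsuppAntidiag.1 m.2).1
  rw [Fin.sum_univ_three] at h4
  have h0 := h 0
  have h1 := h 1
  have h2 := h 2
  omega

/-- A variable whose square divides the given quartic monomial. -/
noncomputable def QuarticExponent.var (m : QuarticExponent) : Fin 3 := m.exists_two_le.choose

theorem QuarticExponent.two_le_var (m : QuarticExponent) : 2 ≤ m.1 m.var :=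
  m.exists_two_le.choose_spec

/-- For the quartic monomial `x^m = xᵢ² x^n`, the form `x^n ∂g/∂xᵢ`. -/
noncomputable def polarQuartic (g : MvPolynomial (Fin 3) R) (m : QuarticExponent) :
    MvPolynomial (Fin 3) R :=
  monomial (m.1 - Finsupp.single m.var 2) 1 * pderiv m.var g

/-- A square minor of the Macaulay matrix of the partial derivatives of a ternary cubic. It does
not vanish identically, and the cubic curve is smooth where it does not vanish. -/
noncomputable def macaulayMinor (g : MvPolynomial (Fin 3) R) : R :=
  (Matrix.of fun m m' : QuarticExponent => coeff m'.1 (polarQuartic g m)).det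

/-- Compatibility with base change lets the minor be formed once over a polynomial ring, for a
varying plane or a generic cubic, and then specialized. -/
theorem map_macaulayMinor (φ : R →+* S) (g : MvPolynomial (Fin 3) R) :
    φ (macaulayMinor g) = macaulayMinor (map φ g) := by
  rw [macaulayMinor, macaulayMinor, RingHom.map_det]
  congr 1
  ext m m'
  simp [polarQuartic, ← coeff_map, pderiv_map]

/-- Each row is `3 x^m`, so the matrix is three times the identity. -/
theorem macaulayMinor_fermat :
    macaulayMinor (∑ i, X i ^ 3 : MvPolynomial (Fin 3) R) =
      3 ^ Fintype.card QuarticExponent := by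
  have h : (Matrix.of fun m m' : QuarticExponent =>
      coeff m'.1 (polarQuartic (∑ i, X i ^ 3 : MvPolynomial (Fin 3) R) m)) =
      (3 : R) • (1 : Matrix QuarticExponent QuarticExponent R) := by
    ext m m'
    have h1 : polarQuartic (∑ i, X i ^ 3 : MvPolynomial (Fin 3) R) m = monomial m.1 3 := by
      have h2 : pderiv m.var (∑ i, X i ^ 3 : MvPolynomial (Fin 3) R) =
          monomial (Finsupp.single m.var 2) 3 := by
        rw [map_sum, Finset.sum_eq_single m.var]
        · rw [pderiv_pow, pderiv_X_self, X_pow_eq_monomial, mul_one, ← map_natCast C,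
            C_mul_monomial, mul_one]
          norm_num
        · intro i _ hi
          simp [pderiv_X_of_ne hi]
        · simp
      rw [polarQuartic, h2, monomial_mul, one_mul, tsub_add_cancel_of_le]
      simpa using m.two_le_var
    rw [Matrix.of_apply, h1, coeff_monomial, Matrix.smul_apply, Matrix.one_apply]
    by_cases hm : m = m'
    · simp [hm]
    · rw [if_neg (fun h => hm (Subtype.ext h)), if_neg hm, smul_zero]
  rw [macaulayMinor, h, Matrix.det_smul, Matrix.det_one, mul_one]

theorem eval_eq_sum_quarticExponent {p : MvPolynomial (Fin 3) ℂ} (hp : p.IsHomogeneous 4)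
    (y : Fin 3 → ℂ) : eval y p = ∑ m : QuarticExponent, coeff m.1 p * ∏ i, y i ^ m.1 i := by
  rw [eval_eq', Finset.sum_coe_sort ((Finset.univ : Finset (Fin 3)).finsuppAntidiag 4)
    (fun m => coeff m p * ∏ i, y i ^ m i)]
  refine Finset.sum_subset (fun m hm => ?_) fun m _ hm => ?_
  · rw [Finset.mem_finsuppAntidiag]
    refine ⟨?_, Finset.subset_univ _⟩
    rw [← Finsupp.degree_eq_sum]
    by_contra h
    exact (mem_support_iff.1 hm) (hp.coeff_eq_zero h)
  · rw [notMem_support_iff.1 hm, zero_mul]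

/-- At a common zero `y` of the partial derivatives, the vector of all quartic monomials in `y` is
in the kernel of the Macaulay matrix. Invertibility gives `y i ^ 4 = 0`. -/
theorem eq_zero_of_macaulayMinor_ne_zero {g : MvPolynomial (Fin 3) ℂ} (hg : g.IsHomogeneous 3)
    (h : macaulayMinor g ≠ 0) {y : Fin 3 → ℂ} (hy : ∀ i, eval y (pderiv i g) = 0) : y = 0 := by
  have hhom : ∀ m, (polarQuartic g m).IsHomogeneous 4 := fun m => by
    have h2 : (m.1 - Finsupp.single m.var 2).degree = 2 := by
      have hle : Finsupp.single m.var 2 ≤ m.1 := by simpa using m.two_le_var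
      have h3 := congrArg Finsupp.degree (tsub_add_cancel_of_le hle)
      have h4 := (Finset.mem_finsuppAntidiag.1 m.2).1
      rw [← Finsupp.degree_eq_sum] at h4
      rw [map_add, Finsupp.degree_single, h4] at h3
      omega
    exact (isHomogeneous_monomial (1 : ℂ) h2).mul (hg.pderiv (i := m.var))
  have h0 := Matrix.eq_zero_of_mulVec_eq_zero h
    (v := fun m : QuarticExponent => ∏ i, y i ^ m.1 i) <| funext fun m => by
      rw [Matrix.mulVec, dotProduct]
      simp only [Matrix.of_apply]
      rw [← eval_eq_sum_quarticExponent (hhom m)]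
      simp [polarQuartic, hy]
  ext i
  have h1 := congrFun h0 ⟨Finsupp.single i 4, by simp [Finset.mem_finsuppAntidiag]⟩
  simp only [Pi.zero_apply, Finsupp.single_apply] at h1
  rw [Finset.prod_eq_single i (fun j _ hj => by simp [hj.symm]) (by simp)] at h1
  simpa using h1

/-- The plane section of a smooth `V` by the span of `w` is a smooth plane cubic if the minor does
not vanish. -/
theorem IsV6.isSmoothPlaneCubic {q f : Coord} (hV : IsV6 q f) {w : Fin 3 → Fin 6 → ℂ}
    (hw : LinearIndependent ℂ w) (hW : Submodule.span ℂ (Set.range w) ∈ planesOn q)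
    (h : macaulayMinor (restrict w f) ≠ 0) :
    IsSmoothPlaneCubic (linearSection q f (Submodule.span ℂ (Set.range w))) := by
  refine ⟨hV.isPlaneCubic_linearSection hW, fun x hx0 hx => ?_⟩
  rw [linearSection_eq hW] at hx ⊢
  have hinj := hw.fintypeLinearCombination_injective
  set W := Submodule.span ℂ (Set.range w) with hWdef
  have hmem : ∀ z, (∀ l : (Fin 6 → ℂ) →ₗ[ℂ] ℂ, (∀ v ∈ W, l v = 0) → l z = 0) → z ∈ W := by
    intro z hz
    by_contra hzW
    obtain ⟨l, hlz, hl⟩ := Submodule.exists_dual_map_eq_bot_of_notMem hzW inferInstance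
    refine hlz (hz l fun v hv => ?_)
    have : l v ∈ W.map l := ⟨v, hv, rfl⟩
    simpa [hl] using this
  have hform : ∀ l : (Fin 6 → ℂ) →ₗ[ℂ] ℂ, (∀ v ∈ W, l v = 0) → linearForm l ∈ linearIdeal W :=
    fun l hl => mem_linearIdeal.2 fun v hv => by rw [eval_linearForm, hl v hv]
  have hxW : x ∈ W := hmem x fun l hl => by
    rw [← eval_linearForm]
    exact hx _ (Ideal.mem_sup_left (hform l hl))
  have hT : tangentSpace (linearIdeal W ⊔ Ideal.span {f}) x =
      W ⊓ LinearMap.ker (differential f x) := by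
    ext v
    rw [Submodule.mem_inf, LinearMap.mem_ker, mem_tangentSpace]
    constructor
    · intro hv
      refine ⟨hmem v fun l hl => ?_,
        hv f (Ideal.mem_sup_right (Ideal.mem_span_singleton_self f))⟩
      rw [← differential_linearForm l x]
      exact hv _ (Ideal.mem_sup_left (hform l hl))
    · rintro ⟨hvW, hvf⟩ p hp
      obtain ⟨a, ha, b, hb, rfl⟩ := Submodule.mem_sup.1 hp
      obtain ⟨k, rfl⟩ := Ideal.mem_span_singleton'.1 hb
      have hfx : eval x f = 0 := hx f (Ideal.mem_sup_right (Ideal.mem_span_singleton_self f))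
      simp [differential_eq_zero_of_mem_linearIdeal ha hxW hvW, hvf, hfx]
  obtain ⟨y, rfl⟩ := mem_span_range_iff_linearCombination.1 hxW
  have hne : differential (restrict w f) y ≠ 0 := by
    intro h0
    have := eq_zero_of_macaulayMinor_ne_zero (restrict_isHomogeneous w hV.2.1) h (y := y)
      fun i => by simpa [differential_apply, Pi.single_apply] using
        LinearMap.congr_fun h0 (Pi.single i 1)
    exact hx0 (by rw [this, map_zero])
  have hker := Module.Dual.finrank_ker_add_one_of_ne_zero hne
  rw [Module.finrank_fin_fun] at hker
  have hmap : W ⊓ LinearMap.ker (differential f (Fintype.linearCombination ℂ w y)) =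
      (LinearMap.ker (differential (restrict w f) y)).map (Fintype.linearCombination ℂ w) := by
    rw [differential_restrict, LinearMap.ker_comp, Submodule.map_comap_eq,
      Fintype.range_linearCombination]
  rw [hT, hmap, ← (Submodule.equivMapOfInjective _ hinj _).finrank_eq]
  omega

end Discriminant

/-! ### Plücker coordinates. -/

section Pluecker

variable {R : Type*} [CommRing R]

/-- The maximal minors of a `3 × 6` matrix. -/
def pluecker (w : Fin 3 → Fin 6 → R) (s : Fin 3 ↪o Fin 6) : R :=
  (Matrix.of fun a b => w a (s b)).det

/-- Row operations. -/
def rowOp (N : Matrix (Fin 3) (Fin 3) R) (w : Fin 3 → Fin 6 → R) : Fin 3 → Fin 6 → R :=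
  fun a j => ∑ b, N a b * w b j

theorem pluecker_rowOp (N : Matrix (Fin 3) (Fin 3) R) (w : Fin 3 → Fin 6 → R)
    (s : Fin 3 ↪o Fin 6) : pluecker (rowOp N w) s = N.det * pluecker w s := by
  rw [pluecker, pluecker, ← Matrix.det_mul]
  congr 1

theorem pluecker_isHomogeneous {g : Fin 3 → Fin 6 → MvPolynomial (Fin 4) ℂ}
    {e : Fin 3 → ℕ} (hg : ∀ a i, (g a i).IsHomogeneous (e a)) (s : Fin 3 ↪o Fin 6) :
    (pluecker g s).IsHomogeneous (∑ a, e a) := by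
  rw [pluecker, ← Matrix.det_transpose, Matrix.det_apply]
  refine IsHomogeneous.sum _ _ _ fun σ _ => ?_
  have h : (∏ i, (Matrix.of fun a b => g a (s b)).transpose (σ i) i).IsHomogeneous (∑ a, e a) :=
    IsHomogeneous.prod _ _ _ fun i _ => hg i _
  rcases Int.units_eq_one_or (Equiv.Perm.sign σ) with h1 | h1
  · simpa [h1] using h
  · simpa [h1] using h.neg

theorem eval_pluecker (g : Fin 3 → Fin 6 → MvPolynomial (Fin 4) ℂ) (t : Fin 4 → ℂ)
    (s : Fin 3 ↪o Fin 6) : eval t (pluecker g s) = pluecker (fun a j => eval t (g a j)) s := by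
  rw [pluecker, RingHom.map_det]
  rfl

/-- The action of a linear map on Plücker coordinates. -/
theorem exists_pluecker_map (A : (Fin 6 → ℂ) →ₗ[ℂ] (Fin 6 → ℂ)) :
    ∃ c : (Fin 3 ↪o Fin 6) → (Fin 3 ↪o Fin 6) → ℂ, ∀ (w : Fin 3 → Fin 6 → ℂ) s,
      pluecker (fun a => A (w a)) s = ∑ s', c s s' * pluecker w s' := by
  let e := Set.powersetCard.ofFinEmbEquiv (n := 3) (I := Fin 6)
  -- The minors are the coordinates of `w₀ ∧ w₁ ∧ w₂` in the standard basis of `Λ³ ℂ⁶`, on which `A`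
  -- acts through `Λ³ A`.
  let b := (Pi.basisFun ℂ (Fin 6)).exteriorPower 3
  have hb : ∀ (w : Fin 3 → Fin 6 → ℂ) s,
      b.repr (exteriorPower.ιMulti ℂ 3 w) s = pluecker w (e.symm s) := fun w s => by
    rw [exteriorPower.basis_repr_apply, exteriorPower.ιMultiDual_apply_ιMulti]
    simp [pluecker, e]
  refine ⟨fun s s' => b.repr (exteriorPower.map 3 A (b (e s'))) (e s), fun w s => ?_⟩
  have h1 := hb (fun a => A (w a)) (e s)
  rw [Equiv.symm_apply_apply] at h1
  have h2 : exteriorPower.ιMulti ℂ 3 (fun a => A (w a)) =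
      exteriorPower.map 3 A (exteriorPower.ιMulti ℂ 3 w) := by
    rw [exteriorPower.map_apply_ιMulti]; rfl
  rw [← h1, h2, ← b.sum_repr (exteriorPower.ιMulti ℂ 3 w), ← e.sum_comp]
  simp [hb, mul_comm]

end Pluecker

/-! ### Families of planes embedded by the complete system of quadrics on `ℙ³`. -/

section Family

/-- A family of planes whose Plücker coordinates are quadrics that span all the quadrics in four
variables. -/
def IsVeroneseFamily (L : (Fin 4 → ℂ) → Submodule ℂ (Fin 6 → ℂ)) : Prop :=
  ∃ p : (Fin 3 ↪o Fin 6) → MvPolynomial (Fin 4) ℂ, (∀ s, (p s).IsHomogeneous 2) ∧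
    (∀ t ≠ 0, ∃ w : Fin 3 → Fin 6 → ℂ, LinearIndependent ℂ w ∧
      Submodule.span ℂ (Set.range w) = L t ∧ ∀ s, pluecker w s = eval t (p s)) ∧
    ∀ i j, X i * X j ∈ Submodule.span ℂ (Set.range p)

/-- The family over projective space defined by a family over affine space. -/
noncomputable def onProj (L : (Fin 4 → ℂ) → Submodule ℂ (Fin 6 → ℂ)) :
    Projectivization ℂ (Fin 4 → ℂ) → Submodule ℂ (Fin 6 → ℂ) := fun t => L t.rep

variable {L : (Fin 4 → ℂ) → Submodule ℂ (Fin 6 → ℂ)}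

theorem onProj_mk (hL : ∀ (c : ℂ) t, c ≠ 0 → L (c • t) = L t) (t : Fin 4 → ℂ) (ht : t ≠ 0) :
    onProj L (Projectivization.mk ℂ t ht) = L t := by
  obtain ⟨a, ha⟩ := Projectivization.exists_smul_eq_mk_rep ℂ t ht
  rw [onProj, ← ha]
  exact hL a t a.ne_zero

theorem range_onProj (hL : ∀ (c : ℂ) t, c ≠ 0 → L (c • t) = L t) :
    Set.range (onProj L) = L '' {t | t ≠ 0} := by
  ext W
  constructor
  · rintro ⟨t, rfl⟩
    exact ⟨_, t.rep_nonzero, rfl⟩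
  · rintro ⟨t, ht, rfl⟩
    exact ⟨_, onProj_mk hL t ht⟩

theorem exists_mul_eq_of_span_eq {w w' : Fin 3 → Fin 6 → ℂ}
    (h : Submodule.span ℂ (Set.range w) = Submodule.span ℂ (Set.range w')) :
    ∃ N : Matrix (Fin 3) (Fin 3) ℂ, w = rowOp N w' := by
  have h1 : ∀ a, ∃ y, Fintype.linearCombination ℂ w' y = w a := fun a =>
    mem_span_range_iff_linearCombination.1 (h ▸ Submodule.subset_span ⟨a, rfl⟩)
  choose N hN using h1
  refine ⟨Matrix.of N, ?_⟩
  ext a i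
  rw [← hN, Fintype.linearCombination_apply, Finset.sum_apply]
  rfl

theorem IsVeroneseFamily.isP3Family (h : IsVeroneseFamily L)
    (hL : ∀ (c : ℂ) t, c ≠ 0 → L (c • t) = L t) : IsP3Family (onProj L) := by
  obtain ⟨p, hp2, hpw, hpX⟩ := h
  refine ⟨fun ℓ ℓ' hℓ => ?_, 2, p, hp2, fun t ht => ?_, fun t ht v hv => ?_⟩
  · induction ℓ using Projectivization.ind with | h t ht
    induction ℓ' using Projectivization.ind with | h t' ht'
    rw [onProj_mk hL, onProj_mk hL] at hℓ
    obtain ⟨w, -, hwL, hwp⟩ := hpw t ht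
    obtain ⟨w', -, hwL', hwp'⟩ := hpw t' ht'
    obtain ⟨N, hN⟩ := exists_mul_eq_of_span_eq (w := w) (w' := w') (by rw [hwL, hwL', hℓ])
    -- Two frames of one plane have proportional Plücker vectors. The coordinates span the quadrics,
    -- so all products `t i * t j` scale by one factor, and `t` is recovered up to a scalar.
    have key : ∀ i j, t i * t j = N.det * (t' i * t' j) := by
      intro i j
      have : ∀ r ∈ Submodule.span ℂ (Set.range p), eval t r = N.det * eval t' r := by
        intro r hr
        induction hr using Submodule.span_induction with
        | mem r hr =>
          obtain ⟨s, rfl⟩ := hr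
          rw [← hwp, ← hwp', hN, pluecker_rowOp]
        | zero => simp
        | add a b _ _ ha hb => simp [ha, hb, mul_add]
        | smul c a _ ha =>
          simp only [smul_eval, ha]
          ring
      simpa using this _ (hpX i j)
    obtain ⟨j, hj⟩ := Function.ne_iff.1 ht
    rw [Projectivization.mk_eq_mk_iff']
    refine ⟨N.det * t' j / t j, funext fun i => ?_⟩
    have := key i j
    simp only [Pi.smul_apply, smul_eq_mul, Pi.zero_apply] at hj ⊢
    field_simp
    linear_combination -this
  · obtain ⟨w, hw, hwL, hwp⟩ := hpw t ht
    exact ⟨w, hw, by rw [hwL, onProj_mk hL], hwp⟩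
  -- The derivative of every `X i * X j` at `t` along `v` vanishes. With `t j ≠ 0`, the case `i = j`
  -- kills `v j`, and then the other `i` kill `v i`.
  · have key : ∀ i j, t i * v j + t j * v i = 0 := by
      intro i j
      have : ∀ r ∈ Submodule.span ℂ (Set.range p), differential r t v = 0 := by
        intro r hr
        induction hr using Submodule.span_induction with
        | mem r hr =>
          obtain ⟨s, rfl⟩ := hr
          exact hv s
        | zero => simp
        | add a b _ _ ha hb => simp [ha, hb]
        | smul c a _ ha => simp [differential_smul, ha]
      simpa [differential_X] using this _ (hpX i j)
    obtain ⟨j, hj⟩ := Function.ne_iff.1 ht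
    have hvj : v j = 0 := by
      have := key j j
      rw [← two_mul] at this
      exact (mul_eq_zero.1 ((mul_eq_zero.1 this).resolve_left two_ne_zero)).resolve_left hj
    ext i
    have := key i j
    rw [hvj, mul_zero, zero_add] at this
    exact (mul_eq_zero.1 this).resolve_left hj

theorem eval_zero_of_isHomogeneous {n : ℕ} {p : MvPolynomial (Fin n) ℂ} {d : ℕ}
    (hp : p.IsHomogeneous d) (hd : d ≠ 0) : eval 0 p = 0 := by
  rw [eval_zero]
  exact hp.coeff_eq_zero (by simpa using hd.symm)

theorem IsVeroneseFamily.map_equiv (h : IsVeroneseFamily L)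
    (A : (Fin 6 → ℂ) ≃ₗ[ℂ] (Fin 6 → ℂ)) :
    IsVeroneseFamily fun t => (L t).map (A : (Fin 6 → ℂ) →ₗ[ℂ] (Fin 6 → ℂ)) := by
  obtain ⟨p, hp2, hpw, hpX⟩ := h
  obtain ⟨c, hc⟩ := exists_pluecker_map (A : (Fin 6 → ℂ) →ₗ[ℂ] (Fin 6 → ℂ))
  obtain ⟨c', hc'⟩ := exists_pluecker_map (A.symm : (Fin 6 → ℂ) →ₗ[ℂ] (Fin 6 → ℂ))
  have hhom : ∀ s, (∑ s', C (c s s') * p s').IsHomogeneous 2 := fun s =>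
    IsHomogeneous.sum _ _ _ fun s' _ => (hp2 s').C_mul _
  refine ⟨fun s => ∑ s', C (c s s') * p s', hhom, fun t ht => ?_, fun i j => ?_⟩
  · obtain ⟨w, hw, hwL, hwp⟩ := hpw t ht
    refine ⟨fun a => A (w a), hw.map' _ A.ker, ?_, fun s => ?_⟩
    · change _ = (L t).map _
      rw [← hwL, Submodule.map_span, ← Set.range_comp]
      rfl
    · have := hc w s
      simp only [LinearEquiv.coe_coe] at this
      rw [this]
      simp [hwp]
  · refine (Submodule.span_le.2 ?_) (hpX i j)
    rintro _ ⟨s', rfl⟩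
    -- The inverse of `A` expresses the old coordinates through the new ones, which therefore still
    -- span.
    have : p s' = ∑ s, c' s' s • ∑ s'', C (c s s'') * p s'' := by
      refine MvPolynomial.funext fun t => ?_
      by_cases ht : t = 0
      · subst ht
        simp only [map_sum, smul_eval, eval_mul, eval_zero_of_isHomogeneous (hp2 _) two_ne_zero,
          mul_zero, Finset.sum_const_zero]
      · obtain ⟨w, hw, hwL, hwp⟩ := hpw t ht
        have h1 := hc' (fun a => A (w a)) s'
        simp only [LinearEquiv.coe_coe, LinearEquiv.symm_apply_apply] at h1
        rw [← hwp, h1, map_sum]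
        refine Finset.sum_congr rfl fun s _ => ?_
        have h2 := hc w s
        simp only [LinearEquiv.coe_coe] at h2
        rw [h2]
        simp [hwp]
    rw [this]
    exact Submodule.sum_mem _ fun s _ => Submodule.smul_mem _ _ (Submodule.subset_span ⟨s, rfl⟩)

theorem isHomogeneous_of_X_pow_mul {n : ℕ} {i : Fin n} {k d : ℕ} {p : MvPolynomial (Fin n) ℂ}
    (h : (X i ^ k * p).IsHomogeneous (k + d)) : p.IsHomogeneous d := by
  intro m hm
  have := @h (m + Finsupp.single i k) (by
    rwa [mul_comm, X_pow_eq_monomial, coeff_mul_monomial, mul_one])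
  rw [map_add] at this
  simp only [Finsupp.weight_single] at this
  simp at this
  omega

/-- A family of planes given by polynomial frames on the four standard charts. -/
theorem isVeroneseFamily_of_charts (g : Fin 4 → Fin 3 → Fin 6 → MvPolynomial (Fin 4) ℂ)
    (k : ℕ) (e : Fin 3 → ℕ) (he : ∑ a, e a = k + 2)
    (hg : ∀ a j, (g 0 a j).IsHomogeneous (e a))
    (hglue : ∀ i, ∃ K N : Matrix (Fin 3) (Fin 3) (MvPolynomial (Fin 4) ℂ),
      rowOp K (g i) = rowOp N (g 0) ∧ K.det ≠ 0 ∧ K.det * X i ^ k = N.det * X 0 ^ k)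
    (hspan : ∀ i j, X 0 ^ k * (X i * X j) ∈ Submodule.span ℂ (Set.range (pluecker (g 0))))
    (hmem : ∀ i t a, (fun j => eval t (g i a j)) ∈ L t)
    (hL : ∀ i t, t i ≠ 0 →
      L t ≤ Submodule.span ℂ (Set.range fun a => (fun j => eval t (g i a j) : Fin 6 → ℂ))) :
    IsVeroneseFamily L := by
  have hrel : ∀ i s, X 0 ^ k * pluecker (g i) s = X i ^ k * pluecker (g 0) s := by
    intro i s
    obtain ⟨K, N, hKN, hK, hdet⟩ := hglue i
    have h1 := congrArg (fun m => pluecker m s) hKN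
    simp only [pluecker_rowOp] at h1
    refine mul_left_cancel₀ hK ?_
    linear_combination X 0 ^ k * h1 - pluecker (g 0) s * hdet
  -- Chart 1 suffices to see that `X 0 ^ k` divides the minors of chart 0, because `X 0` is prime to
  -- `X 1`. The quotients `p s` are the global Plücker coordinates.
  have hX0 : (X 0 : MvPolynomial (Fin 4) ℂ) ^ k ≠ 0 := pow_ne_zero _ (X_ne_zero 0)
  have hdvd : ∀ s, ∃ p, pluecker (g 0) s = X 0 ^ k * p := by
    intro s
    refine (X_prime (i := (0 : Fin 4))).pow_dvd_of_dvd_mul_left k (a := X 1 ^ k) (fun h => ?_)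
      ⟨_, (hrel 1 s).symm⟩
    have := (X_prime (i := (0 : Fin 4))).dvd_of_dvd_pow h
    rw [X_dvd_X] at this
    simp at this
  choose p hp using hdvd
  have hpi : ∀ i s, pluecker (g i) s = X i ^ k * p s := fun i s =>
    mul_left_cancel₀ hX0 (by rw [hrel, hp]; ring)
  have hspan' : ∀ i j, X i * X j ∈ Submodule.span ℂ (Set.range p) := by
    intro i j
    have h1 : Set.range (pluecker (g 0)) = LinearMap.mulLeft ℂ (X 0 ^ k) '' Set.range p := by
      rw [← Set.range_comp]
      exact congrArg Set.range (funext hp)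
    have h2 := hspan i j
    rw [h1, ← Submodule.map_span] at h2
    obtain ⟨r, hr, hr2⟩ := h2
    rwa [← mul_left_cancel₀ hX0 hr2]
  refine ⟨p, fun s => isHomogeneous_of_X_pow_mul (i := 0) (k := k) ?_, fun t ht => ?_, hspan'⟩
  · rw [← hp, ← he]
    exact pluecker_isHomogeneous hg s
  · obtain ⟨i, hi⟩ := Function.ne_iff.1 ht
    simp only [Pi.zero_apply] at hi
    have hik := pow_ne_zero k hi
    set w : Fin 3 → Fin 6 → ℂ := fun a j => eval t (g i a j) with hwdef
    -- Rescaling one row removes the factor `t i ^ k` from all minors.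
    let D : Matrix (Fin 3) (Fin 3) ℂ := Matrix.diagonal ![(t i ^ k)⁻¹, 1, 1]
    have hwp : ∀ s, pluecker w s = t i ^ k * eval t (p s) := fun s => by
      have := congrArg (eval t) (hpi i s)
      rwa [eval_pluecker, map_mul, map_pow, eval_X] at this
    have hDw : ∀ a, (rowOp D w) a = (![(t i ^ k)⁻¹, 1, 1] : Fin 3 → ℂ) a • w a := fun a => by
      ext j
      simp [rowOp, D, Matrix.diagonal_apply]
    have hDp : ∀ s, pluecker (rowOp D w) s = eval t (p s) := fun s => by
      rw [pluecker_rowOp, hwp, Matrix.det_diagonal]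
      simp [Fin.prod_univ_three, hik]
    refine ⟨rowOp D w, ?_, ?_, hDp⟩
    · obtain ⟨s, hs⟩ : ∃ s, eval t (p s) ≠ 0 := by
        by_contra! h0
        have : ∀ r ∈ Submodule.span ℂ (Set.range p), eval t r = 0 := by
          intro r hr
          induction hr using Submodule.span_induction with
          | mem r hr =>
            obtain ⟨s, rfl⟩ := hr
            exact h0 s
          | zero => simp
          | add a b _ _ ha hb => simp [ha, hb]
          | smul c a _ ha => simp [smul_eval, ha]
        exact hi (by simpa using this _ (hspan' i i))
      have hu : IsUnit (Matrix.of fun a b => rowOp D w a (s b)) :=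
        (Matrix.isUnit_iff_isUnit_det _).2 (isUnit_iff_ne_zero.2 (by rw [← hDp] at hs; exact hs))
      have := Matrix.linearIndependent_rows_iff_isUnit.2 hu
      exact LinearIndependent.of_comp (LinearMap.funLeft ℂ ℂ s) this
    · refine le_antisymm (Submodule.span_le.2 ?_) ((hL i t hi).trans (Submodule.span_le.2 ?_))
      · rintro _ ⟨a, rfl⟩
        rw [hDw]
        exact Submodule.smul_mem _ _ (hmem i t a)
      · rintro _ ⟨a, rfl⟩
        have hne : (![(t i ^ k)⁻¹, 1, 1] : Fin 3 → ℂ) a ≠ 0 := by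
          fin_cases a <;> simp [hi]
        have : w a = ((![(t i ^ k)⁻¹, 1, 1] : Fin 3 → ℂ) a)⁻¹ • (rowOp D w) a := by
          rw [hDw, inv_smul_smul₀ hne]
        change w a ∈ _
        rw [this]
        exact Submodule.smul_mem _ _ (Submodule.subset_span ⟨a, rfl⟩)

end Family

/-! ### Explicit families of planes in normal form, with polynomial frames. -/

section KleinPlanes

/-- In `ℂ³ ⊕ ℂ³` with the quadratic form `u ⬝ v`, the totally isotropic subspace of all `(u, v)`
with `t₀ v = τ × u` and `τ ⬝ v = 0`, where `t = (t₀, τ)`. -/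
def kleinPlane (t : Fin 4 → ℂ) : Submodule ℂ (Fin 6 → ℂ) where
  carrier := {y | t 0 * y 3 = t 2 * y 2 - t 3 * y 1 ∧ t 0 * y 4 = t 3 * y 0 - t 1 * y 2 ∧
    t 0 * y 5 = t 1 * y 1 - t 2 * y 0 ∧ t 1 * y 3 + t 2 * y 4 + t 3 * y 5 = 0}
  add_mem' := by
    rintro y z ⟨h1, h2, h3, h4⟩ ⟨k1, k2, k3, k4⟩
    simp only [Set.mem_ofPred_eq, Pi.add_apply]
    refine ⟨?_, ?_, ?_, ?_⟩
    · linear_combination h1 + k1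
    · linear_combination h2 + k2
    · linear_combination h3 + k3
    · linear_combination h4 + k4
  zero_mem' := by simp
  smul_mem' := by
    rintro c y ⟨h1, h2, h3, h4⟩
    simp only [Set.mem_ofPred_eq, Pi.smul_apply, smul_eq_mul]
    refine ⟨?_, ?_, ?_, ?_⟩
    · linear_combination c * h1
    · linear_combination c * h2
    · linear_combination c * h3
    · linear_combination c * h4

theorem mem_kleinPlane {t : Fin 4 → ℂ} {y : Fin 6 → ℂ} : y ∈ kleinPlane t ↔
    t 0 * y 3 = t 2 * y 2 - t 3 * y 1 ∧ t 0 * y 4 = t 3 * y 0 - t 1 * y 2 ∧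
      t 0 * y 5 = t 1 * y 1 - t 2 * y 0 ∧ t 1 * y 3 + t 2 * y 4 + t 3 * y 5 = 0 := Iff.rfl

theorem kleinPlane_smul (c : ℂ) (t : Fin 4 → ℂ) (hc : c ≠ 0) :
    kleinPlane (c • t) = kleinPlane t := by
  ext y
  simp only [mem_kleinPlane, Pi.smul_apply, smul_eq_mul, mul_assoc, ← mul_sub, ← mul_add,
    mul_right_inj' hc, mul_eq_zero, hc, false_or]

/-- The projection of the cone over a smooth quadric in `ℙ⁴` from its vertex, followed by the
embedding of this quadric into a smooth quadric in `ℙ⁵` as a hyperplane section. -/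
def coneProj : (Fin 6 → ℂ) →ₗ[ℂ] (Fin 6 → ℂ) :=
  LinearMap.funLeft ℂ ℂ ![0, 1, 2, 3, 4, 2]

theorem coneProj_apply (y : Fin 6 → ℂ) : coneProj y = ![y 0, y 1, y 2, y 3, y 4, y 2] := by
  ext j
  fin_cases j <;> rfl

/-- The planes on the cone `y₀ y₃ + y₁ y₄ + y₂² = 0`. -/
def conePlane (t : Fin 4 → ℂ) : Submodule ℂ (Fin 6 → ℂ) := (kleinPlane t).comap coneProj

theorem mem_conePlane {t : Fin 4 → ℂ} {y : Fin 6 → ℂ} : y ∈ conePlane t ↔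
    t 0 * y 3 = t 2 * y 2 - t 3 * y 1 ∧ t 0 * y 4 = t 3 * y 0 - t 1 * y 2 ∧
      t 0 * y 2 = t 1 * y 1 - t 2 * y 0 ∧ t 1 * y 3 + t 2 * y 4 + t 3 * y 2 = 0 := by
  rw [conePlane, Submodule.mem_comap, mem_kleinPlane]
  rfl

theorem conePlane_smul (c : ℂ) (t : Fin 4 → ℂ) (hc : c ≠ 0) :
    conePlane (c • t) = conePlane t := by
  rw [conePlane, kleinPlane_smul c t hc, conePlane]

/-- Frames of the planes `kleinPlane t` on the standard charts. -/
noncomputable def kleinFrame : Fin 4 → Fin 3 → Fin 6 → MvPolynomial (Fin 4) ℂ :=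
  -- Here `x = (τ, 0)` and `w_a = (t₀ e_a, τ × e_a)`. Since `X 1 w₀ + X 2 w₁ + X 3 w₂ = X 0 x`, each
  -- chart `tᵢ ≠ 0` with `i > 0` replaces one `w` by `x`.
  let x := ![X 1, X 2, X 3, 0, 0, 0]
  let w₀ := ![X 0, 0, 0, 0, X 3, -X 2]
  let w₁ := ![0, X 0, 0, -X 3, 0, X 1]
  let w₂ := ![0, 0, X 0, X 2, -X 1, 0]
  ![![w₀, w₁, w₂], ![x, w₁, w₂], ![w₀, x, w₂], ![w₀, w₁, x]]

/-- Frames of the planes `conePlane t` on the standard charts. -/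
noncomputable def coneFrame : Fin 4 → Fin 3 → Fin 6 → MvPolynomial (Fin 4) ℂ :=
  let e := ![0, 0, 0, 0, 0, 1]
  -- Besides `y₅`, the free coordinates on the four charts are `(y₀, y₁)`, `(y₀, y₄)`, `(y₃, y₁)`
  -- and `(y₄, y₃)`; each row solves the equations for one of them, with denominators `tᵢ²` cleared.
  let r₀ := ![X 0 ^ 2, 0, -(X 0 * X 2), -X 2 ^ 2, X 0 * X 3 + X 1 * X 2, 0]
  let r₁ := ![0, X 0 ^ 2, X 0 * X 1, X 1 * X 2 - X 0 * X 3, -X 1 ^ 2, 0]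
  let r₂ := ![X 1 ^ 2, X 1 * X 2 + X 0 * X 3, X 1 * X 3, -X 3 ^ 2, 0, 0]
  let r₃ := ![X 0 * X 3 - X 1 * X 2, -X 2 ^ 2, -(X 2 * X 3), 0, X 3 ^ 2, 0]
  ![![r₀, r₁, e], ![r₂, r₁, e], ![r₀, -r₃, e], ![r₃, r₂, e]]

/-- The increasing triple `i < j < k`. -/
def triple (i j k : Fin 6) (h : i < j ∧ j < k) : Fin 3 ↪o Fin 6 :=
  OrderEmbedding.ofStrictMono ![i, j, k] (by
    intro a b hab
    fin_cases a <;> fin_cases b <;> simp_all [h.1.trans h.2])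

theorem pluecker_triple {R : Type*} [CommRing R] (w : Fin 3 → Fin 6 → R) (i j k : Fin 6)
    (h : i < j ∧ j < k) : pluecker w (triple i j k h) =
      w 0 i * w 1 j * w 2 k - w 0 i * w 1 k * w 2 j - w 0 j * w 1 i * w 2 k +
        w 0 j * w 1 k * w 2 i + w 0 k * w 1 i * w 2 j - w 0 k * w 1 j * w 2 i := by
  rw [pluecker, Matrix.det_fin_three]
  rfl

theorem mem_span_pluecker {g : Fin 3 → Fin 6 → MvPolynomial (Fin 4) ℂ}
    {r : MvPolynomial (Fin 4) ℂ} (c : ℂ) (i j k : Fin 6) (h : i < j ∧ j < k)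
    (hr : r = C c * pluecker g (triple i j k h)) :
    r ∈ Submodule.span ℂ (Set.range (pluecker g)) := by
  rw [hr, ← smul_eq_C_mul]
  exact Submodule.smul_mem _ _ (Submodule.subset_span ⟨_, rfl⟩)

theorem kleinFrame_span (i j : Fin 4) : (X 0 ^ 1 * (X i * X j) : MvPolynomial (Fin 4) ℂ) ∈
    Submodule.span ℂ (Set.range (pluecker (kleinFrame 0))) := by
  wlog hij : i ≤ j generalizing i j
  · rw [mul_comm (X i)]
    exact this j i (le_of_not_ge hij)
  fin_cases i <;> fin_cases j <;> first | exact absurd hij (by decide) | skip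
  · refine mem_span_pluecker 1 0 1 2 (by decide) ?_
    simp [pluecker_triple, kleinFrame]; ring
  · refine mem_span_pluecker (-1) 0 1 4 (by decide) ?_
    simp [pluecker_triple, kleinFrame]; ring
  · refine mem_span_pluecker 1 0 1 3 (by decide) ?_
    simp [pluecker_triple, kleinFrame]; ring
  · refine mem_span_pluecker 1 0 2 3 (by decide) ?_
    simp [pluecker_triple, kleinFrame]; ring
  · refine mem_span_pluecker 1 0 4 5 (by decide) ?_
    simp [pluecker_triple, kleinFrame]; ring
  · refine mem_span_pluecker (-1) 0 3 5 (by decide) ?_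
    simp [pluecker_triple, kleinFrame]; ring
  · refine mem_span_pluecker 1 0 3 4 (by decide) ?_
    simp [pluecker_triple, kleinFrame]; ring
  · refine mem_span_pluecker (-1) 1 3 5 (by decide) ?_
    simp [pluecker_triple, kleinFrame]; ring
  · refine mem_span_pluecker 1 1 3 4 (by decide) ?_
    simp [pluecker_triple, kleinFrame]; ring
  · refine mem_span_pluecker 1 2 3 4 (by decide) ?_
    simp [pluecker_triple, kleinFrame]; ring

/-- Eight of the ten monomials are minors up to sign and the factor `X 0 ^ 2`. The remaining `X 0 *
X 3` and `X 1 * X 2` come from their sum and difference, which requires dividing by 2. -/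
theorem coneFrame_span (i j : Fin 4) : (X 0 ^ 2 * (X i * X j) : MvPolynomial (Fin 4) ℂ) ∈
    Submodule.span ℂ (Set.range (pluecker (coneFrame 0))) := by
  wlog hij : i ≤ j generalizing i j
  · rw [mul_comm (X i)]
    exact this j i (le_of_not_ge hij)
  have hsum : (X 0 ^ 2 * (X 0 * X 3) + X 0 ^ 2 * (X 1 * X 2) : MvPolynomial (Fin 4) ℂ) ∈
      Submodule.span ℂ (Set.range (pluecker (coneFrame 0))) := by
    refine mem_span_pluecker (-1) 1 4 5 (by decide) ?_
    simp [pluecker_triple, coneFrame]; ring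
  have hdiff : (X 0 ^ 2 * (X 1 * X 2) - X 0 ^ 2 * (X 0 * X 3) : MvPolynomial (Fin 4) ℂ) ∈
      Submodule.span ℂ (Set.range (pluecker (coneFrame 0))) := by
    refine mem_span_pluecker 1 0 3 5 (by decide) ?_
    simp [pluecker_triple, coneFrame]; ring
  have half : ∀ r : MvPolynomial (Fin 4) ℂ, (1 / 2 : ℂ) • (r + r) = r := fun r => by
    rw [← two_smul ℂ, smul_smul]
    norm_num
  fin_cases i <;> fin_cases j <;> first | exact absurd hij (by decide) | skip
  · refine mem_span_pluecker 1 0 1 5 (by decide) ?_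
    simp [pluecker_triple, coneFrame]; ring
  · refine mem_span_pluecker 1 0 2 5 (by decide) ?_
    simp [pluecker_triple, coneFrame]
  · refine mem_span_pluecker 1 1 2 5 (by decide) ?_
    simp [pluecker_triple, coneFrame]; ring
  · have := Submodule.smul_mem _ (1 / 2 : ℂ) (Submodule.sub_mem _ hsum hdiff)
    rwa [add_comm (X 0 ^ 2 * (X 0 * X 3)), add_sub_sub_cancel, half] at this
  · refine mem_span_pluecker (-1) 0 4 5 (by decide) ?_
    simp [pluecker_triple, coneFrame]; ring
  · have := Submodule.smul_mem _ (1 / 2 : ℂ) (Submodule.add_mem _ hsum hdiff)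
    rwa [add_comm (X 0 ^ 2 * (X 0 * X 3)), add_add_sub_cancel, half] at this
  · refine mem_span_pluecker (-1) 2 4 5 (by decide) ?_
    simp [pluecker_triple, coneFrame]; ring
  · refine mem_span_pluecker 1 1 3 5 (by decide) ?_
    simp [pluecker_triple, coneFrame]; ring
  · refine mem_span_pluecker 1 2 3 5 (by decide) ?_
    simp [pluecker_triple, coneFrame]; ring
  · refine mem_span_pluecker 1 3 4 5 (by decide) ?_
    simp [pluecker_triple, coneFrame]; ring

theorem kleinFrame_mem (i : Fin 4) (t : Fin 4 → ℂ) (a : Fin 3) :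
    (fun j => eval t (kleinFrame i a j)) ∈ kleinPlane t := by
  rw [mem_kleinPlane]
  fin_cases i <;> fin_cases a <;> simp [kleinFrame] <;> grind

theorem coneFrame_mem (i : Fin 4) (t : Fin 4 → ℂ) (a : Fin 3) :
    (fun j => eval t (coneFrame i a j)) ∈ conePlane t := by
  rw [mem_conePlane]
  fin_cases i <;> fin_cases a <;> simp [coneFrame] <;> grind

theorem kleinPlane_le_span (i : Fin 4) (t : Fin 4 → ℂ) (hi : t i ≠ 0) : kleinPlane t ≤
    Submodule.span ℂ (Set.range fun a => (fun j => eval t (kleinFrame i a j) : Fin 6 → ℂ)) := by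
  rintro y ⟨h1, h2, h3, h4⟩
  rw [Submodule.mem_span_range_iff_exists_fun]
  refine ⟨(t i)⁻¹ • (![![y 0, y 1, y 2], ![y 0, y 5, -y 4], ![-y 5, y 1, y 3],
    ![y 4, -y 3, y 2]] : Fin 4 → Fin 3 → ℂ) i, ?_⟩
  ext j
  rw [Fin.sum_univ_three]
  fin_cases i <;> fin_cases j <;> simp [kleinFrame] at hi ⊢ <;> grind

theorem conePlane_le_span (i : Fin 4) (t : Fin 4 → ℂ) (hi : t i ≠ 0) : conePlane t ≤
    Submodule.span ℂ (Set.range fun a => (fun j => eval t (coneFrame i a j) : Fin 6 → ℂ)) := by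
  intro y hy
  obtain ⟨h1, h2, h3, h4⟩ := mem_conePlane.1 hy
  rw [Submodule.mem_span_range_iff_exists_fun]
  refine ⟨(![![y 0 / t 0 ^ 2, y 1 / t 0 ^ 2, y 5], ![y 0 / t 1 ^ 2, -y 4 / t 1 ^ 2, y 5],
    ![-y 3 / t 2 ^ 2, y 1 / t 2 ^ 2, y 5],
    ![y 4 / t 3 ^ 2, -y 3 / t 3 ^ 2, y 5]] : Fin 4 → Fin 3 → ℂ) i, ?_⟩
  ext j
  rw [Fin.sum_univ_three]
  fin_cases i <;> fin_cases j <;> simp [coneFrame] at hi ⊢ <;> field_simp <;> grind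

theorem isVeroneseFamily_kleinPlane : IsVeroneseFamily kleinPlane := by
  refine isVeroneseFamily_of_charts kleinFrame 1 ![1, 1, 1] rfl (fun a j => ?_) (fun i => ?_)
    kleinFrame_span kleinFrame_mem kleinPlane_le_span
  · fin_cases a <;> fin_cases j <;> simp [kleinFrame, isHomogeneous_X, isHomogeneous_zero,
      IsHomogeneous.neg]
  · refine ⟨![1, !![X 0, 0, 0; 0, 1, 0; 0, 0, 1], !![1, 0, 0; 0, X 0, 0; 0, 0, 1],
        !![1, 0, 0; 0, 1, 0; 0, 0, X 0]] i,
      ![1, !![X 1, X 2, X 3; 0, 1, 0; 0, 0, 1], !![1, 0, 0; X 1, X 2, X 3; 0, 0, 1],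
        !![1, 0, 0; 0, 1, 0; X 1, X 2, X 3]] i, ?_, ?_, ?_⟩
    · ext1 a
      ext1 j
      fin_cases i <;> fin_cases a <;> fin_cases j <;>
        simp [rowOp, kleinFrame, Fin.sum_univ_three] <;> ring
    · fin_cases i <;> simp [Matrix.det_fin_three]
    · fin_cases i <;> simp [Matrix.det_fin_three] <;> ring

theorem isVeroneseFamily_conePlane : IsVeroneseFamily conePlane := by
  refine isVeroneseFamily_of_charts coneFrame 2 ![2, 2, 0] rfl (fun a j => ?_) (fun i => ?_)
    coneFrame_span coneFrame_mem conePlane_le_span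
  · have h2 : ∀ i j, (X i * X j : MvPolynomial (Fin 4) ℂ).IsHomogeneous 2 :=
      fun i j => (isHomogeneous_X ℂ i).mul (isHomogeneous_X ℂ j)
    fin_cases a <;> fin_cases j <;> simp [coneFrame, isHomogeneous_X_pow, isHomogeneous_zero,
      IsHomogeneous.neg, IsHomogeneous.add, IsHomogeneous.sub, h2, isHomogeneous_one]
  -- The matrices encode `X₀² r₂ = X₁² r₀ + (X₁X₂ + X₀X₃) r₁` and `X₀² r₃ = (X₀X₃ - X₁X₂) r₀ - X₂²
  -- r₁`.
  · refine ⟨![1, !![X 0 ^ 2, 0, 0; 0, 1, 0; 0, 0, 1], !![1, 0, 0; 0, X 0 ^ 2, 0; 0, 0, 1],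
        !![X 0 ^ 2, 0, 0; 0, X 0 ^ 2, 0; 0, 0, 1]] i,
      ![1, !![X 1 ^ 2, X 1 * X 2 + X 0 * X 3, 0; 0, 1, 0; 0, 0, 1],
        !![1, 0, 0; X 1 * X 2 - X 0 * X 3, X 2 ^ 2, 0; 0, 0, 1],
        !![X 0 * X 3 - X 1 * X 2, -X 2 ^ 2, 0; X 1 ^ 2, X 0 * X 3 + X 1 * X 2, 0; 0, 0, 1]] i,
      ?_, ?_, ?_⟩
    · ext1 a
      ext1 j
      fin_cases i <;> fin_cases a <;> fin_cases j <;>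
        simp [rowOp, coneFrame, Fin.sum_univ_three] <;> ring
    · fin_cases i <;> simp [Matrix.det_fin_three]
    · fin_cases i <;> simp [Matrix.det_fin_three] <;> ring

end KleinPlanes

/-! ### Classification of the planes on the quadrics in normal form. -/

section IsotropicPlanes

/-- The smooth quadric fourfold in normal form. -/
noncomputable def kleinQuadric : Coord := X 0 * X 3 + X 1 * X 4 + X 2 * X 5

/-- The cone over the smooth quadric threefold in normal form. -/
noncomputable def coneQuadric : Coord := X 0 * X 3 + X 1 * X 4 + X 2 ^ 2

theorem eval_kleinQuadric (y : Fin 6 → ℂ) :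
    eval y kleinQuadric = y 0 * y 3 + y 1 * y 4 + y 2 * y 5 := by
  simp [kleinQuadric]

theorem eval_coneQuadric (y : Fin 6 → ℂ) :
    eval y coneQuadric = y 0 * y 3 + y 1 * y 4 + y 2 ^ 2 := by
  simp [coneQuadric]

/-- The exchange of the two summands of `ℂ³ ⊕ ℂ³`. -/
def swapHalves : (Fin 6 → ℂ) ≃ₗ[ℂ] (Fin 6 → ℂ) := LinearEquiv.funCongrLeft ℂ ℂ (Equiv.addRight 3)

theorem swapHalves_apply (y : Fin 6 → ℂ) : swapHalves y = ![y 3, y 4, y 5, y 0, y 1, y 2] := by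
  ext j
  fin_cases j <;> rfl

theorem swapHalves_swapHalves (y : Fin 6 → ℂ) : swapHalves (swapHalves y) = y := by
  ext j
  fin_cases j <;> rfl

theorem swapHalves_symm_apply (y : Fin 6 → ℂ) : swapHalves.symm y = swapHalves y := by
  rw [LinearEquiv.symm_apply_eq, swapHalves_swapHalves]

theorem mem_map_swapHalves {W : Submodule ℂ (Fin 6 → ℂ)} {y : Fin 6 → ℂ} :
    y ∈ W.map (swapHalves : (Fin 6 → ℂ) →ₗ[ℂ] (Fin 6 → ℂ)) ↔ swapHalves y ∈ W := by
  rw [Submodule.mem_map_equiv, swapHalves_symm_apply]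

/-- The planes of the second family on the Klein quadric. -/
def dualKleinPlane (t : Fin 4 → ℂ) : Submodule ℂ (Fin 6 → ℂ) :=
  (kleinPlane t).map (swapHalves : (Fin 6 → ℂ) →ₗ[ℂ] (Fin 6 → ℂ))

theorem mem_dualKleinPlane {t : Fin 4 → ℂ} {y : Fin 6 → ℂ} : y ∈ dualKleinPlane t ↔
    t 0 * y 0 = t 2 * y 5 - t 3 * y 4 ∧ t 0 * y 1 = t 3 * y 3 - t 1 * y 5 ∧
      t 0 * y 2 = t 1 * y 4 - t 2 * y 3 ∧ t 1 * y 0 + t 2 * y 1 + t 3 * y 2 = 0 :=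
  mem_map_swapHalves

theorem IsVeroneseFamily.finrank {L : (Fin 4 → ℂ) → Submodule ℂ (Fin 6 → ℂ)}
    (h : IsVeroneseFamily L) {t : Fin 4 → ℂ} (ht : t ≠ 0) : Module.finrank ℂ (L t) = 3 := by
  obtain ⟨p, -, hpw, -⟩ := h
  obtain ⟨w, hw, hwL, -⟩ := hpw t ht
  rw [← hwL, finrank_span_eq_card hw, Fintype.card_fin]

theorem isVeroneseFamily_dualKleinPlane : IsVeroneseFamily dualKleinPlane :=
  isVeroneseFamily_kleinPlane.map_equiv swapHalves

theorem fin_four_ne_zero {t : Fin 4 → ℂ} (ht : t ≠ 0) :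
    t 0 ≠ 0 ∨ t 1 ≠ 0 ∨ t 2 ≠ 0 ∨ t 3 ≠ 0 := by
  obtain ⟨i, hi⟩ := Function.ne_iff.1 ht
  fin_cases i <;> simp_all

theorem kleinPlane_isotropic {t : Fin 4 → ℂ} (ht : t ≠ 0) {y : Fin 6 → ℂ}
    (hy : y ∈ kleinPlane t) : y 0 * y 3 + y 1 * y 4 + y 2 * y 5 = 0 := by
  obtain ⟨h1, h2, h3, h4⟩ := hy
  rcases fin_four_ne_zero ht with h | h | h | h <;> refine (mul_eq_zero.1 ?_).resolve_left h
  · linear_combination y 0 * h1 + y 1 * h2 + y 2 * h3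
  · linear_combination y 0 * h4 + y 5 * h2 - y 4 * h3
  · linear_combination y 1 * h4 - y 5 * h1 + y 3 * h3
  · linear_combination y 2 * h4 + y 4 * h1 - y 3 * h2

theorem dualKleinPlane_isotropic {t : Fin 4 → ℂ} (ht : t ≠ 0) {y : Fin 6 → ℂ}
    (hy : y ∈ dualKleinPlane t) : y 0 * y 3 + y 1 * y 4 + y 2 * y 5 = 0 := by
  have := kleinPlane_isotropic ht (mem_map_swapHalves.1 hy)
  rw [swapHalves_apply] at this
  simp only [Matrix.cons_val] at this
  linear_combination this

theorem kleinPlane_ne_dualKleinPlane {t t' : Fin 4 → ℂ} (ht : t ≠ 0) (ht' : t' ≠ 0) :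
    kleinPlane t ≠ dualKleinPlane t' := by
  intro h
  have hmem : ∀ i a, (fun j => eval t (kleinFrame i a j)) ∈ dualKleinPlane t' := fun i a =>
    h ▸ kleinFrame_mem i t a
  have hx := hmem 1 0
  have h0 := hmem 0 0
  have h1 := hmem 0 1
  have h2 := hmem 0 2
  rw [mem_dualKleinPlane] at hx h0 h1 h2
  simp [kleinFrame] at hx h0 h1 h2
  rcases fin_four_ne_zero ht with h | h | h | h <;>
    rcases fin_four_ne_zero ht' with h' | h' | h' | h' <;> grind

/-- Write `y = (u, v)` and `z = (u', 0)`; then `v` is orthogonal to `u` and `u'`. If `n = u' × u ≠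
0`, then `v` is parallel to `n`, and `t = (nᵢ, vᵢ u')` works when `nᵢ ≠ 0`. Otherwise `t₀ = 0` and
`τ` is `u'`, or `u`, or, if both vanish, a vector orthogonal to `v`. -/
theorem exists_mem_kleinPlane_of_eq_zero {y z : Fin 6 → ℂ}
    (hy : y 0 * y 3 + y 1 * y 4 + y 2 * y 5 = 0) (hz3 : z 3 = 0) (hz4 : z 4 = 0) (hz5 : z 5 = 0)
    (hyz : z 0 * y 3 + z 1 * y 4 + z 2 * y 5 = 0) :
    ∃ t ≠ 0, y ∈ kleinPlane t ∧ z ∈ kleinPlane t := by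
  simp only [mem_kleinPlane, hz3, hz4, hz5]
  by_cases h0 : z 1 * y 2 - z 2 * y 1 = 0
  · by_cases h1 : z 2 * y 0 - z 0 * y 2 = 0
    · by_cases h2 : z 0 * y 1 - z 1 * y 0 = 0
      · by_cases hz : z 0 = 0 ∧ z 1 = 0 ∧ z 2 = 0
        · obtain ⟨hz0, hz1, hz2⟩ := hz
          by_cases hu : y 0 = 0 ∧ y 1 = 0 ∧ y 2 = 0
          · obtain ⟨hu0, hu1, hu2⟩ := hu
            by_cases hv : y 3 = 0
            · refine ⟨![0, 1, 0, 0], fun h => by simpa using congrFun h 1, ?_⟩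
              simp [hu0, hu1, hu2, hz0, hz1, hz2, hv]
            · refine ⟨![0, y 4, -y 3, 0], fun h => hv (by simpa using congrFun h 2), ?_⟩
              simp [hu0, hu1, hu2, hz0, hz1, hz2]
              ring
          · refine ⟨![0, y 0, y 1, y 2], fun h => hu ⟨by simpa using congrFun h 1,
              by simpa using congrFun h 2, by simpa using congrFun h 3⟩, ?_⟩
            simp [hz0, hz1, hz2, hy, mul_comm]
        · refine ⟨![0, z 0, z 1, z 2], fun h => hz ⟨by simpa using congrFun h 1,
            by simpa using congrFun h 2, by simpa using congrFun h 3⟩, ?_⟩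
          simp [mul_comm] 
          grind
      · refine ⟨![z 0 * y 1 - z 1 * y 0, y 5 * z 0, y 5 * z 1, y 5 * z 2],
          fun h => h2 (by simpa using congrFun h 0), ?_⟩
        simp
        grind
    · refine ⟨![z 2 * y 0 - z 0 * y 2, y 4 * z 0, y 4 * z 1, y 4 * z 2],
        fun h => h1 (by simpa using congrFun h 0), ?_⟩
      simp
      grind
  · refine ⟨![z 1 * y 2 - z 2 * y 1, y 3 * z 0, y 3 * z 1, y 3 * z 2],
      fun h => h0 (by simpa using congrFun h 0), ?_⟩
    simp
    grind

/-- Two orthogonal isotropic vectors lie in a common plane of the first family. -/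
theorem exists_mem_kleinPlane {y z : Fin 6 → ℂ} (hy : y 0 * y 3 + y 1 * y 4 + y 2 * y 5 = 0)
    (hz : z 0 * z 3 + z 1 * z 4 + z 2 * z 5 = 0)
    (hyz : y 0 * z 3 + y 1 * z 4 + y 2 * z 5 + (z 0 * y 3 + z 1 * y 4 + z 2 * y 5) = 0) :
    ∃ t ≠ 0, y ∈ kleinPlane t ∧ z ∈ kleinPlane t := by
  -- For `y = (u, v)` and `z = (u', v')` the solution is `t = (v ⬝ u', v × v')` unless this
  -- vanishes. In that case `v` and `v'` are parallel, and a linear combination reduces to a vector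
  -- with zero second half.
  by_cases ht : y 3 * z 0 + y 4 * z 1 + y 5 * z 2 = 0 ∧ y 4 * z 5 - y 5 * z 4 = 0 ∧
      y 5 * z 3 - y 3 * z 5 = 0 ∧ y 3 * z 4 - y 4 * z 3 = 0
  · obtain ⟨h0, h1, h2, h3⟩ := ht
    by_cases hv : y 3 = 0 ∧ y 4 = 0 ∧ y 5 = 0
    · obtain ⟨t, ht, hzt, hyt⟩ := exists_mem_kleinPlane_of_eq_zero hz hv.1 hv.2.1 hv.2.2
        (z := y) (by linear_combination hyz - h0)
      exact ⟨t, ht, hyt, hzt⟩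
    · have key : ∀ a b : ℂ, a ≠ 0 → a * z 3 = b * y 3 → a * z 4 = b * y 4 → a * z 5 = b * y 5 →
          ∃ t ≠ 0, y ∈ kleinPlane t ∧ z ∈ kleinPlane t := by
        intro a b ha e3 e4 e5
        obtain ⟨t, ht, hyt, hzt⟩ := exists_mem_kleinPlane_of_eq_zero hy (z := a • z - b • y)
          (by simp [e3]) (by simp [e4]) (by simp [e5])
          (by
            simp only [Pi.sub_apply, Pi.smul_apply, smul_eq_mul]
            linear_combination a * h0 - b * hy)
        refine ⟨t, ht, hyt, ?_⟩
        have : z = a⁻¹ • ((a • z - b • y) + b • y) := by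
          rw [sub_add_cancel, inv_smul_smul₀ ha]
        rw [this]
        exact Submodule.smul_mem _ _ (Submodule.add_mem _ hzt (Submodule.smul_mem _ _ hyt))
      by_cases hv3 : y 3 = 0
      · by_cases hv4 : y 4 = 0
        · have hv5 : y 5 ≠ 0 := fun h => hv ⟨hv3, hv4, h⟩
          exact key (y 5) (z 5) hv5 (by linear_combination h2) (by linear_combination -h1)
            (mul_comm _ _)
        · exact key (y 4) (z 4) hv4 (by linear_combination -h3) (mul_comm _ _)
            (by linear_combination h1)
      · exact key (y 3) (z 3) hv3 (mul_comm _ _) (by linear_combination h3)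
          (by linear_combination -h2)
  · refine ⟨![y 3 * z 0 + y 4 * z 1 + y 5 * z 2, y 4 * z 5 - y 5 * z 4,
      y 5 * z 3 - y 3 * z 5, y 3 * z 4 - y 4 * z 3], fun h => ht ⟨by simpa using congrFun h 0,
        by simpa using congrFun h 1, by simpa using congrFun h 2, by simpa using congrFun h 3⟩, ?_⟩
    simp only [mem_kleinPlane, Matrix.cons_val]
    refine ⟨⟨?_, ?_, ?_, ?_⟩, ?_, ?_, ?_, ?_⟩
    · linear_combination y 3 * hyz - z 3 * hy
    · linear_combination y 4 * hyz - z 4 * hy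
    · linear_combination y 5 * hyz - z 5 * hy
    · ring
    · linear_combination y 3 * hz
    · linear_combination y 4 * hz
    · linear_combination y 5 * hz
    · ring

theorem polar_eq_zero {W : Submodule ℂ (Fin 6 → ℂ)}
    (hW : ∀ y ∈ W, y 0 * y 3 + y 1 * y 4 + y 2 * y 5 = 0) {y z : Fin 6 → ℂ} (hy : y ∈ W)
    (hz : z ∈ W) :
    y 0 * z 3 + y 1 * z 4 + y 2 * z 5 + (z 0 * y 3 + z 1 * y 4 + z 2 * y 5) = 0 := by
  have := hW _ (W.add_mem hy hz)
  simp only [Pi.add_apply] at this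
  linear_combination this - hW y hy - hW z hz

/-- Here `W` is the graph of a linear map `u ↦ v`. Isotropy makes it skew, and a skew endomorphism
of `ℂ³` is a cross product `τ × u`; the entries of `τ` are read off from the images of basis
vectors. -/
theorem exists_le_kleinPlane_of_graph {W : Submodule ℂ (Fin 6 → ℂ)}
    (hW3 : Module.finrank ℂ W = 3) (hW : ∀ y ∈ W, y 0 * y 3 + y 1 * y 4 + y 2 * y 5 = 0)
    (h : ∀ y ∈ W, y 0 = 0 → y 1 = 0 → y 2 = 0 → y = 0) : ∃ t ≠ 0, W ≤ kleinPlane t := by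
  let P : W →ₗ[ℂ] (Fin 3 → ℂ) := LinearMap.funLeft ℂ ℂ ![0, 1, 2] ∘ₗ W.subtype
  have hP : Function.Injective P := by
    rw [← LinearMap.ker_eq_bot, LinearMap.ker_eq_bot']
    intro y hy
    exact Subtype.ext (h y y.2 (congrFun hy 0) (congrFun hy 1) (congrFun hy 2))
  have hP' : Function.Surjective P :=
    (LinearMap.injective_iff_surjective_of_finrank_eq_finrank (by simp [hW3])).1 hP
  obtain ⟨⟨a, ha⟩, haP⟩ := hP' ![1, 0, 0]
  obtain ⟨⟨b, hb⟩, hbP⟩ := hP' ![0, 1, 0]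
  obtain ⟨⟨c, hc⟩, hcP⟩ := hP' ![0, 0, 1]
  have a0 : a 0 = 1 := congrFun haP 0
  have a1 : a 1 = 0 := congrFun haP 1
  have a2 : a 2 = 0 := congrFun haP 2
  have b0 : b 0 = 0 := congrFun hbP 0
  have b1 : b 1 = 1 := congrFun hbP 1
  have b2 : b 2 = 0 := congrFun hbP 2
  have c0 : c 0 = 0 := congrFun hcP 0
  have c1 : c 1 = 0 := congrFun hcP 1
  have c2 : c 2 = 1 := congrFun hcP 2
  refine ⟨![1, b 5, -a 5, a 4], fun h => by simpa using congrFun h 0, fun y hy => ?_⟩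
  have haa := hW a ha
  have hbb := hW b hb
  have hcc := hW c hc
  have hab := polar_eq_zero hW ha hb
  have hac := polar_eq_zero hW ha hc
  have hbc := polar_eq_zero hW hb hc
  have hya := polar_eq_zero hW hy ha
  have hyb := polar_eq_zero hW hy hb
  have hyc := polar_eq_zero hW hy hc
  have hyy := hW y hy
  simp only [a0, a1, a2, b0, b1, b2, c0, c1, c2] at *
  simp only [mem_kleinPlane, Matrix.cons_val]
  grind

theorem finrank_map_swapHalves (W : Submodule ℂ (Fin 6 → ℂ)) :
    Module.finrank ℂ (W.map (swapHalves : (Fin 6 → ℂ) →ₗ[ℂ] (Fin 6 → ℂ))) =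
      Module.finrank ℂ W :=
  LinearEquiv.finrank_map_eq swapHalves W

theorem exists_le_kleinPlane_or_dual {W : Submodule ℂ (Fin 6 → ℂ)}
    (hW3 : Module.finrank ℂ W = 3) (hW : ∀ y ∈ W, y 0 * y 3 + y 1 * y 4 + y 2 * y 5 = 0) :
    (∃ t ≠ 0, W ≤ kleinPlane t) ∨ ∃ t ≠ 0, W ≤ dualKleinPlane t := by
  by_cases hk : ∀ y ∈ W, y 0 = 0 → y 1 = 0 → y 2 = 0 → y = 0
  · exact Or.inl (exists_le_kleinPlane_of_graph hW3 hW hk)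
  by_cases hk' : ∀ y ∈ W, y 3 = 0 → y 4 = 0 → y 5 = 0 → y = 0
  · right
    obtain ⟨t, ht, hle⟩ := exists_le_kleinPlane_of_graph
      (W := W.map (swapHalves : (Fin 6 → ℂ) →ₗ[ℂ] (Fin 6 → ℂ)))
      (by rw [finrank_map_swapHalves, hW3])
      (fun y hy => by
        have := hW _ (mem_map_swapHalves.1 hy)
        rw [swapHalves_apply] at this
        simp only [Matrix.cons_val] at this
        linear_combination this)
      (fun y hy h0 h1 h2 => by
        have := hk' _ (mem_map_swapHalves.1 hy) h0 h1 h2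
        rwa [map_eq_zero_iff _ swapHalves.injective] at this)
    exact ⟨t, ht, fun y hy => mem_map_swapHalves.2
      (hle (mem_map_swapHalves.2 (by rwa [swapHalves_swapHalves])))⟩
  push Not at hk hk'
  obtain ⟨k, hk, k0, k1, k2, hk0⟩ := hk
  obtain ⟨l, hl, l3, l4, l5, hl0⟩ := hk'
  have hkl := polar_eq_zero hW hk hl
  -- `W` now contains `k = (0, κ)` and `l = (λ, 0)`. Either all first halves are parallel to `λ`,
  -- and `W` is in the first family with `t = (0, λ)`, or the first half of some `y` is not. Then
  -- all second halves turn out parallel to `κ`, and `t = (0, κ)` works in the second family.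
  by_cases hu : ∀ y ∈ W, l 1 * y 2 - l 2 * y 1 = 0 ∧ l 2 * y 0 - l 0 * y 2 = 0 ∧
      l 0 * y 1 - l 1 * y 0 = 0
  · refine Or.inl ⟨![0, l 0, l 1, l 2], fun h => hl0 ?_, fun y hy => ?_⟩
    · have h0 : l 0 = 0 := congrFun h 1
      have h1 : l 1 = 0 := congrFun h 2
      have h2 : l 2 = 0 := congrFun h 3
      ext j
      fin_cases j <;> simpa
    · obtain ⟨h1, h2, h3⟩ := hu y hy
      have := polar_eq_zero hW hl hy
      simp only [mem_kleinPlane, Matrix.cons_val]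
      grind
  · push Not at hu
    obtain ⟨y, hy, hne⟩ := hu
    refine Or.inr ⟨![0, k 3, k 4, k 5], fun h => hk0 ?_, fun z hz => ?_⟩
    · have h0 : k 3 = 0 := congrFun h 1
      have h1 : k 4 = 0 := congrFun h 2
      have h2 : k 5 = 0 := congrFun h 3
      ext j
      fin_cases j <;> simpa
    · have e1 := polar_eq_zero hW hk hy
      have e2 := polar_eq_zero hW hl hy
      have e3 := hW y hy
      have e4 := polar_eq_zero hW hz hk
      have e5 := polar_eq_zero hW hz hl
      have e6 := polar_eq_zero hW hz hy
      simp only [mem_dualKleinPlane, Matrix.cons_val]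
      simp only [k0, k1, k2, l3, l4, l5, zero_mul, mul_zero, add_zero, zero_add]
        at hkl e1 e2 e4 e5 e6 ⊢
      -- The vectors of `ℂ³` orthogonal to both `λ` and the first half of `y` form a line, which
      -- contains `κ`.
      have cross : ∀ a b : Fin 6 → ℂ, l 0 * a 3 + l 1 * a 4 + l 2 * a 5 = 0 →
          y 0 * a 3 + y 1 * a 4 + y 2 * a 5 = 0 → l 0 * b 3 + l 1 * b 4 + l 2 * b 5 = 0 →
          y 0 * b 3 + y 1 * b 4 + y 2 * b 5 = 0 →
          a 3 * b 4 = a 4 * b 3 ∧ a 4 * b 5 = a 5 * b 4 ∧ a 5 * b 3 = a 3 * b 5 := by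
        intro a b ha1 ha2 hb1 hb2
        by_cases n0 : l 1 * y 2 - l 2 * y 1 = 0
        · by_cases n1 : l 2 * y 0 - l 0 * y 2 = 0
          · have n2 := hne n0 n1
            refine ⟨?_, ?_, ?_⟩ <;> grind
          · refine ⟨?_, ?_, ?_⟩ <;> grind
        · refine ⟨?_, ?_, ?_⟩ <;> grind
      have hkv := cross k y hkl e1 e2 e3
      have huv : z 0 * y 3 + z 1 * y 4 + z 2 * y 5 = 0 := by
        by_contra hne0
        refine hk0 ?_
        have h3 : k 3 = 0 := by grind
        have h4 : k 4 = 0 := by grind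
        have h5 : k 5 = 0 := by grind
        ext j
        fin_cases j <;> simpa
      have hkz := cross k z hkl e1 e5 (by linear_combination e6 - huv)
      grind

theorem planesOn_kleinQuadric :
    planesOn kleinQuadric = kleinPlane '' {t | t ≠ 0} ∪ dualKleinPlane '' {t | t ≠ 0} := by
  ext W
  simp only [planesOn, eval_kleinQuadric]
  constructor
  · rintro ⟨hW3, hW⟩
    refine (exists_le_kleinPlane_or_dual hW3 hW).imp ?_ ?_
    · rintro ⟨t, ht, hle⟩
      exact ⟨t, ht, (Submodule.eq_of_le_of_finrank_eq hle
        (by rw [hW3, isVeroneseFamily_kleinPlane.finrank ht])).symm⟩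
    · rintro ⟨t, ht, hle⟩
      exact ⟨t, ht, (Submodule.eq_of_le_of_finrank_eq hle
        (by rw [hW3, isVeroneseFamily_dualKleinPlane.finrank ht])).symm⟩
  · rintro (⟨t, ht, rfl⟩ | ⟨t, ht, rfl⟩)
    · exact ⟨isVeroneseFamily_kleinPlane.finrank ht, fun y hy => kleinPlane_isotropic ht hy⟩
    · exact ⟨isVeroneseFamily_dualKleinPlane.finrank ht,
        fun y hy => dualKleinPlane_isotropic ht hy⟩

theorem finrank_ker_coneProj : Module.finrank ℂ (LinearMap.ker coneProj) ≤ 1 := by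
  have : LinearMap.ker coneProj ≤ Submodule.span ℂ {(Pi.single 5 1 : Fin 6 → ℂ)} := by
    intro y hy
    rw [LinearMap.mem_ker, coneProj_apply] at hy
    refine Submodule.mem_span_singleton.2 ⟨y 5, ?_⟩
    have h := congrFun hy
    ext j
    fin_cases j
    · simpa using (h 0).symm
    · simpa using (h 1).symm
    · simpa using (h 2).symm
    · simpa using (h 3).symm
    · simpa using (h 4).symm
    · simp
  exact (Submodule.finrank_mono this).trans (finrank_span_singleton (by simp)).le

theorem planesOn_coneQuadric : planesOn coneQuadric = conePlane '' {t | t ≠ 0} := by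
  ext W
  simp only [planesOn, eval_coneQuadric]
  constructor
  · rintro ⟨hW3, hW⟩
    set F := W.map coneProj with hF
    have hFiso : ∀ y ∈ F, y 0 * y 3 + y 1 * y 4 + y 2 * y 5 = 0 := by
      rintro _ ⟨y, hy, rfl⟩
      rw [coneProj_apply]
      simp only [Matrix.cons_val]
      linear_combination hW y hy
    have hFH : ∀ y ∈ F, y 5 = y 2 := by
      rintro _ ⟨y, hy, rfl⟩
      rfl
    have hrank := LinearMap.finrank_range_add_finrank_ker (coneProj.domRestrict W)
    rw [LinearMap.range_domRestrict, ← hF, hW3, LinearMap.ker_domRestrict] at hrank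
    have hker : Module.finrank ℂ ((LinearMap.ker coneProj).comap W.subtype) ≤ 1 :=
      le_trans (by
        rw [(Submodule.equivMapOfInjective W.subtype W.injective_subtype _).finrank_eq]
        exact Submodule.finrank_mono (Submodule.map_comap_le _ _)) finrank_ker_coneProj
    -- In dimension 2, `F` is a line of the quadric threefold, and `W` is the preimage of a Klein
    -- plane through it. Dimension 3 is impossible: no plane of either family lies in the hyperplane
    -- `y₅ = y₂`.
    obtain hF2 | hF3 : Module.finrank ℂ F = 2 ∨ Module.finrank ℂ F = 3 := by omega
    · obtain ⟨w, hw, hwF⟩ := exists_frame hF2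
      have hmem : ∀ a, w a ∈ F := fun a => hwF ▸ Submodule.subset_span ⟨a, rfl⟩
      obtain ⟨t, ht, h0, h1⟩ := exists_mem_kleinPlane (hFiso _ (hmem 0)) (hFiso _ (hmem 1))
        (polar_eq_zero hFiso (hmem 0) (hmem 1))
      have hle : W ≤ conePlane t := by
        rw [conePlane, ← Submodule.map_le_iff_le_comap, ← hF, ← hwF, Submodule.span_le]
        rintro _ ⟨a, rfl⟩
        fin_cases a
        · exact h0
        · exact h1
      exact ⟨t, ht, (Submodule.eq_of_le_of_finrank_eq hle
        (by rw [hW3, isVeroneseFamily_conePlane.finrank ht])).symm⟩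
    · exfalso
      rcases exists_le_kleinPlane_or_dual hF3 hFiso with ⟨t, ht, hle⟩ | ⟨t, ht, hle⟩
      · have := Submodule.eq_of_le_of_finrank_eq hle
          (by rw [hF3, isVeroneseFamily_kleinPlane.finrank ht])
        have h : ∀ i a, eval t (kleinFrame i a 5) = eval t (kleinFrame i a 2) := fun i a =>
          hFH _ (this ▸ kleinFrame_mem i t a)
        have h1 := h 1 0
        have h2 := h 0 0
        have h3 := h 0 1
        have h4 := h 0 2
        simp [kleinFrame] at h1 h2 h3 h4
        rcases fin_four_ne_zero ht with h | h | h | h <;> simp_all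
      · have := Submodule.eq_of_le_of_finrank_eq hle
          (by rw [hF3, isVeroneseFamily_dualKleinPlane.finrank ht])
        have h : ∀ i a, eval t (kleinFrame i a 2) = eval t (kleinFrame i a 5) := fun i a => by
          have hm : swapHalves (fun j => eval t (kleinFrame i a j)) ∈ F := by
            rw [this]
            exact mem_map_swapHalves.2 (by
              rw [swapHalves_swapHalves]
              exact kleinFrame_mem i t a)
          exact hFH _ hm
        have h1 := h 1 0
        have h2 := h 0 0
        have h3 := h 0 1
        have h4 := h 0 2
        simp [kleinFrame] at h1 h2 h3 h4
        rcases fin_four_ne_zero ht with h | h | h | h <;> simp_all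
  · rintro ⟨t, ht, rfl⟩
    refine ⟨isVeroneseFamily_conePlane.finrank ht, fun y hy => ?_⟩
    have := kleinPlane_isotropic ht (Submodule.mem_comap.1 hy)
    rw [coneProj_apply] at this
    simp only [Matrix.cons_val] at this
    linear_combination this

end IsotropicPlanes

/-! ### Normal forms of quadrics of rank 6 and 5. -/

section NormalForm

theorem pderiv_comm {n : ℕ} (i j : Fin n) (p : MvPolynomial (Fin n) ℂ) :
    pderiv i (pderiv j p) = pderiv j (pderiv i p) := by
  let D (k : Fin n) : Derivation ℂ (MvPolynomial (Fin n) ℂ) (MvPolynomial (Fin n) ℂ) := pderiv k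
  have h : ⁅D i, D j⁆ = 0 := by
    refine MvPolynomial.derivation_ext fun k => ?_
    rw [Derivation.commutator_apply]
    simp only [D, pderiv_X]
    simp only [Pi.single_apply, Derivation.zero_apply]
    split_ifs <;> simp
  have := congrArg (fun d => d p) h
  simpa [D, Derivation.commutator_apply, sub_eq_zero] using this

/-- The Hessian matrix of a quadratic form. -/
noncomputable def hessian (q : Coord) : Matrix (Fin 6) (Fin 6) ℂ :=
  Matrix.of fun i j => constantCoeff (pderiv i (pderiv j q))

theorem hessian_isSymm (q : Coord) : (hessian q).IsSymm := by
  ext i j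
  simp [hessian, pderiv_comm i j]

/-- Euler's formula applied to `q` and again to its partial derivatives. -/
theorem two_mul_eval_quadric {q : Coord} (hq : q.IsHomogeneous 2) (y : Fin 6 → ℂ) :
    2 * eval y q = Matrix.toBilin' (hessian q) y y := by
  have h1 := congrArg (eval y) hq.sum_X_mul_pderiv
  have h2 : ∀ j, eval y (pderiv j q) = ∑ i, y i * hessian q i j := fun j => by
    have h3 := congrArg (eval y) (hq.pderiv (i := j)).sum_X_mul_pderiv
    have h4 : ∀ i, pderiv i (pderiv j q) = C (hessian q i j) := fun i => by
      have h5 := (hq.pderiv (i := j)).pderiv (i := i)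
      exact totalDegree_eq_zero_iff_eq_C.1 ((totalDegree_zero_iff_isHomogeneous _).2 h5)
    simpa [h4] using h3.symm
  simp only [map_sum, map_mul, eval_X, h2] at h1
  rw [Matrix.toBilin'_apply, Finset.sum_comm]
  simp only [nsmul_eq_mul, Nat.cast_ofNat, map_mul, map_ofNat] at h1
  rw [← h1]
  refine Finset.sum_congr rfl fun j _ => ?_
  rw [Finset.mul_sum]
  exact Finset.sum_congr rfl fun i _ => by ring

/-- Diagonalization of a quadratic form over the complex numbers. -/
theorem exists_diagonal {q : Coord} (hq : q.IsHomogeneous 2) :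
    ∃ (E : (Fin 6 → ℂ) ≃ₗ[ℂ] (Fin 6 → ℂ)) (d : Fin 6 → ℂ),
      Fintype.card {i // d i ≠ 0} = quadricRank q ∧
      ∀ y, eval (E y) q = ∑ i, if d i = 0 then 0 else y i ^ 2 := by
  let B := Matrix.toBilin' (hessian q)
  have hB : B.IsSymm := Matrix.isSymm_toBilin'_iff_isSymm.2 (hessian_isSymm q)
  let _ : Invertible (2 : ℂ) := invertibleOfNonzero two_ne_zero
  obtain ⟨v', hv'⟩ := LinearMap.BilinForm.exists_orthogonal_basis
    (LinearMap.BilinForm.isSymm_iff.1 hB)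
  let v := v'.reindex (finCongr (Module.finrank_fin_fun ℂ))
  have hv : ∀ i j, i ≠ j → B (v i) (v j) = 0 := fun i j hij => by
    simp only [v, Module.Basis.reindex_apply]
    exact hv' (fun h => hij (Equiv.injective _ h))
  let d : Fin 6 → ℂ := fun i => B (v i) (v i)
  have hdiag : LinearMap.BilinForm.toMatrix v B = Matrix.diagonal d := by
    ext i j
    rw [LinearMap.BilinForm.toMatrix_apply, Matrix.diagonal_apply]
    split_ifs with h
    · rw [h]
    · exact hv i j h
  have hrank : quadricRank q = Fintype.card {i // d i ≠ 0} := by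
    have h1 := LinearMap.BilinForm.toMatrix_mul_basis_toMatrix (Pi.basisFun ℂ (Fin 6)) v B
    have h2 : LinearMap.BilinForm.toMatrix (Pi.basisFun ℂ (Fin 6)) B = hessian q := by
      rw [LinearMap.BilinForm.toMatrix_basisFun]
      exact LinearMap.BilinForm.toMatrix'_toBilin' _
    have hu : IsUnit ((Pi.basisFun ℂ (Fin 6)).toMatrix v).det := by
      rw [← Matrix.isUnit_iff_isUnit_det]
      let _ := (Pi.basisFun ℂ (Fin 6)).invertibleToMatrix v
      exact isUnit_of_invertible _
    rw [h2, hdiag] at h1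
    rw [← Matrix.rank_diagonal, ← h1, Matrix.rank_mul_eq_left_of_isUnit_det _ _ hu,
      Matrix.rank_mul_eq_right_of_isUnit_det _ _ (by rwa [Matrix.det_transpose])]
    rfl
  -- The basis vectors are normalized to value 2, not 1, because the Hessian form computes `2 q`.
  have hs : ∀ i, ∃ s : ℂ, s ≠ 0 ∧ s ^ 2 * d i = if d i = 0 then 0 else 2 := fun i => by
    by_cases h : d i = 0
    · exact ⟨1, one_ne_zero, by simp [h]⟩
    · obtain ⟨s, hs⟩ := IsAlgClosed.exists_pow_nat_eq (2 / d i) (n := 2) two_pos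
      refine ⟨s, ?_, ?_⟩
      · rintro rfl
        exact div_ne_zero two_ne_zero h (by simpa using hs.symm)
      · rw [hs, if_neg h, div_mul_cancel₀ _ h]
  choose s hs0 hsd using hs
  let o := v.unitsSMul fun i => Units.mk0 (s i) (hs0 i)
  refine ⟨o.equivFun.symm, d, hrank.symm, fun y => ?_⟩
  have h2 := two_mul_eval_quadric hq (o.equivFun.symm y)
  refine mul_left_cancel₀ (two_ne_zero (α := ℂ)) (h2.trans ?_)
  have ho : ∀ i, o i = s i • v i := fun i => Module.Basis.unitsSMul_apply i
  change B _ _ = _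
  rw [Module.Basis.equivFun_symm_apply, LinearMap.BilinForm.sum_left, Finset.mul_sum]
  refine Finset.sum_congr rfl fun i _ => ?_
  rw [LinearMap.BilinForm.sum_right, Finset.sum_eq_single i]
  · have := hsd i
    simp only [ho, LinearMap.BilinForm.smul_left, LinearMap.BilinForm.smul_right]
    change y i * (s i * (y i * (s i * d i))) = _
    split_ifs at this ⊢ <;> linear_combination y i ^ 2 * this
  · intro j _ hij
    simp [ho, hv i j hij.symm]
  · simp

/-- The change of coordinates that diagonalizes `kleinQuadric`. -/
noncomputable def kleinDiagonal : (Fin 6 → ℂ) ≃ₗ[ℂ] (Fin 6 → ℂ) where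
  toFun y := ![(y 0 + y 3) / 2, (y 1 + y 4) / 2, (y 2 + y 5) / 2, Complex.I * (y 0 - y 3) / 2,
    Complex.I * (y 1 - y 4) / 2, Complex.I * (y 2 - y 5) / 2]
  invFun z := ![z 0 - Complex.I * z 3, z 1 - Complex.I * z 4, z 2 - Complex.I * z 5,
    z 0 + Complex.I * z 3, z 1 + Complex.I * z 4, z 2 + Complex.I * z 5]
  map_add' y z := by ext j; fin_cases j <;> simp <;> ring
  map_smul' c y := by ext j; fin_cases j <;> simp <;> ring
  left_inv y := by ext j; fin_cases j <;> simp <;> ring_nf <;> simp <;> ring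
  right_inv z := by ext j; fin_cases j <;> simp <;> ring_nf <;> simp

/-- The change of coordinates that diagonalizes `coneQuadric`. -/
noncomputable def coneDiagonal : (Fin 6 → ℂ) ≃ₗ[ℂ] (Fin 6 → ℂ) where
  toFun y := ![(y 0 + y 3) / 2, (y 1 + y 4) / 2, y 2, Complex.I * (y 0 - y 3) / 2,
    Complex.I * (y 1 - y 4) / 2, y 5]
  invFun z := ![z 0 - Complex.I * z 3, z 1 - Complex.I * z 4, z 2,
    z 0 + Complex.I * z 3, z 1 + Complex.I * z 4, z 5]
  map_add' y z := by ext j; fin_cases j <;> simp <;> ring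
  map_smul' c y := by ext j; fin_cases j <;> simp <;> ring
  left_inv y := by ext j; fin_cases j <;> simp <;> ring_nf <;> simp <;> ring
  right_inv z := by ext j; fin_cases j <;> simp <;> ring_nf <;> simp

theorem exists_klein_normalForm {q : Coord} (hq : q.IsHomogeneous 2) (hr : quadricRank q = 6) :
    ∃ A : (Fin 6 → ℂ) ≃ₗ[ℂ] (Fin 6 → ℂ), ∀ y, eval (A y) q = eval y kleinQuadric := by
  obtain ⟨E, d, hd, hE⟩ := exists_diagonal hq
  have hd0 : ∀ i, d i ≠ 0 := by
    rw [hr, Fintype.card_subtype] at hd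
    have := Finset.eq_univ_of_card _ (by rw [hd, Fintype.card_fin])
    exact fun i => by simpa using Finset.ext_iff.1 this i
  refine ⟨kleinDiagonal.trans E, fun y => ?_⟩
  rw [LinearEquiv.trans_apply, hE, eval_kleinQuadric]
  simp only [hd0, if_false, Fin.sum_univ_six, kleinDiagonal, LinearEquiv.coe_mk, LinearMap.coe_mk,
    AddHom.coe_mk, Matrix.cons_val]
  ring_nf
  simp only [Complex.I_sq]
  ring

theorem exists_cone_normalForm {q : Coord} (hq : q.IsHomogeneous 2) (hr : quadricRank q = 5) :
    ∃ A : (Fin 6 → ℂ) ≃ₗ[ℂ] (Fin 6 → ℂ), ∀ y, eval (A y) q = eval y coneQuadric := by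
  obtain ⟨E, d, hd, hE⟩ := exists_diagonal hq
  obtain ⟨k, hk⟩ : ∃ k, ∀ i, d i = 0 ↔ i = k := by
    rw [hr, Fintype.card_subtype] at hd
    have h1 := Finset.card_filter_add_card_filter_not (s := Finset.univ) (fun i => d i ≠ 0)
    rw [hd, Finset.card_univ, Fintype.card_fin] at h1
    obtain ⟨k, hk⟩ := Finset.card_eq_one.1 (show
      (Finset.univ.filter fun i => ¬ d i ≠ 0).card = 1 by omega)
    exact ⟨k, fun i => by simpa using Finset.ext_iff.1 hk i⟩
  -- The swap moves the one degenerate diagonal entry to the last coordinate.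
  refine ⟨(coneDiagonal.trans (LinearEquiv.funCongrLeft ℂ ℂ (Equiv.swap k 5))).trans E,
    fun y => ?_⟩
  have hsum : ∀ z : Fin 6 → ℂ, eval (E (LinearEquiv.funCongrLeft ℂ ℂ (Equiv.swap k 5) z)) q =
      z 0 ^ 2 + z 1 ^ 2 + z 2 ^ 2 + z 3 ^ 2 + z 4 ^ 2 := fun z => by
    rw [hE, ← Equiv.sum_comp (Equiv.swap k 5)]
    simp only [hk, LinearEquiv.funCongrLeft_apply, LinearMap.funLeft_apply, Equiv.swap_apply_self,
      Equiv.swap_apply_eq_iff, Equiv.swap_apply_left]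
    simp [Fin.sum_univ_six]
  rw [LinearEquiv.trans_apply, LinearEquiv.trans_apply, hsum, eval_coneQuadric]
  simp only [coneDiagonal, LinearEquiv.coe_mk, LinearMap.coe_mk, AddHom.coe_mk, Matrix.cons_val]
  ring_nf
  simp only [Complex.I_sq]
  ring

end NormalForm

/-! ### Smoothness of the intersection with the Fermat cubic. -/

section Smoothness

theorem isV6_of_independent {q f : Coord} (hq : q.IsHomogeneous 2) (hf : f.IsHomogeneous 3)
    (h : ∀ x ≠ 0, eval x q = 0 → eval x f = 0 → ∀ α β : ℂ,
      α • differential q x + β • differential f x = 0 → α = 0 ∧ β = 0) : IsV6 q f := by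
  refine ⟨hq, hf, fun x hx hxI => ?_⟩
  have hqx := hxI q (Ideal.subset_span (by simp))
  have hfx := hxI f (Ideal.subset_span (by simp))
  rw [tangentSpace_span_pair hqx hfx, ← LinearMap.ker_prod]
  have hsurj : LinearMap.range ((differential q x).prod (differential f x)) = ⊤ := by
    by_contra hne
    obtain ⟨l, hl0, hl⟩ := Submodule.exists_dual_map_eq_bot_of_lt_top (lt_top_iff_ne_top.2 hne)
      inferInstance
    have hlin : ∀ p : ℂ × ℂ, l p = l (1, 0) * p.1 + l (0, 1) * p.2 := fun p => by
      have : p = p.1 • ((1 : ℂ), (0 : ℂ)) + p.2 • ((0 : ℂ), (1 : ℂ)) := by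
        ext <;> simp
      conv_lhs => rw [this]
      rw [map_add, map_smul, map_smul, smul_eq_mul, smul_eq_mul]
      ring
    obtain ⟨h1, h2⟩ := h x hx hqx hfx (l (1, 0)) (l (0, 1)) <| LinearMap.ext fun v => by
      have h3 : l ((differential q x).prod (differential f x) v) ∈
          (LinearMap.range ((differential q x).prod (differential f x))).map l :=
        ⟨_, ⟨v, rfl⟩, rfl⟩
      rw [hl, Submodule.mem_bot, hlin] at h3
      simpa using h3
    exact hl0 (LinearMap.ext fun p => by rw [hlin, h1, h2]; simp)
  have := LinearMap.finrank_range_add_finrank_ker ((differential q x).prod (differential f x))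
  rw [hsurj, finrank_top, Module.finrank_prod, Module.finrank_self, Module.finrank_fin_fun] at this
  omega

/-- The Fermat cubic form. -/
noncomputable def fermatCubic (n : ℕ) : MvPolynomial (Fin n) ℂ := ∑ i, X i ^ 3

theorem eval_fermatCubic {n : ℕ} (y : Fin n → ℂ) : eval y (fermatCubic n) = ∑ i, y i ^ 3 := by
  simp [fermatCubic]

theorem fermatCubic_isHomogeneous (n : ℕ) : (fermatCubic n).IsHomogeneous 3 :=
  IsHomogeneous.sum _ _ _ fun i _ => isHomogeneous_X_pow i 3

theorem differential_X_apply {n : ℕ} (i : Fin n) (x : Fin n → ℂ) :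
    differential (X i) x = LinearMap.proj i :=
  LinearMap.ext fun v => differential_X i x v

theorem differential_fermatCubic (x v : Fin 6 → ℂ) :
    differential (fermatCubic 6) x v = ∑ i, 3 * x i ^ 2 * v i := by
  rw [differential_apply]
  refine Finset.sum_congr rfl fun i _ => ?_
  congr 1
  rw [fermatCubic, map_sum, Finset.sum_eq_single i]
  · simp
  · intro j _ hj
    simp [pderiv_X_of_ne hj]
  · simp

/-- These are the Lagrange equations for a pair of dual coordinates. The pair contributes either 0
or `c²` to the quadric. -/
theorem pair_dichotomy {a b c : ℂ} (h1 : a ^ 2 = c * b) (h2 : b ^ 2 = c * a) :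
    a = 0 ∧ b = 0 ∨ c ≠ 0 ∧ a * b = c ^ 2 := by
  by_cases hc : c = 0
  · left
    subst hc
    simpa using And.intro h1 h2
  · by_cases ha : a = 0
    · left
      subst ha
      simpa using h2
    · refine Or.inr ⟨hc, ?_⟩
      have h3 : a * (a * b - c ^ 2) = 0 := by linear_combination b * h1 + c * h2
      linear_combination (mul_eq_zero.1 h3).resolve_left ha

/-- If `β ≠ 0`, the quadric takes the value `k c²` at `x`, where `k` counts the nonzero pairs. It
vanishes there, so `k = 0` and `x = 0`. -/
theorem independent_kleinQuadric {x : Fin 6 → ℂ} (hx : x ≠ 0) (hq : eval x kleinQuadric = 0)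
    {α β : ℂ} (h : α • differential kleinQuadric x + β • differential (fermatCubic 6) x = 0) :
    α = 0 ∧ β = 0 := by
  have h' : ∀ v, α * differential kleinQuadric x v + β * ∑ i, 3 * x i ^ 2 * v i = 0 := fun v => by
    rw [← differential_fermatCubic]
    exact LinearMap.congr_fun h v
  have hi := fun i => h' (Pi.single i 1)
  simp [kleinQuadric, differential_X_apply, Pi.single_apply] at hi
  have e0 := hi 0
  have e1 := hi 1
  have e2 := hi 2
  have e3 := hi 3
  have e4 := hi 4
  have e5 := hi 5
  simp at e0 e1 e2 e3 e4 e5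
  by_cases hβ : β = 0
  · refine ⟨?_, hβ⟩
    by_contra hα
    refine hx (funext fun j => ?_)
    subst hβ
    fin_cases j <;> simp_all
  · exfalso
    rw [eval_kleinQuadric] at hq
    obtain ⟨c, rfl⟩ : ∃ c, α = -3 * β * c := ⟨-α / (3 * β), by field_simp⟩
    have p0 := pair_dichotomy (a := x 0) (b := x 3) (c := c) (by grind) (by grind)
    have p1 := pair_dichotomy (a := x 1) (b := x 4) (c := c) (by grind) (by grind)
    have p2 := pair_dichotomy (a := x 2) (b := x 5) (c := c) (by grind) (by grind)
    have hx' : ¬ (x 0 = 0 ∧ x 1 = 0 ∧ x 2 = 0 ∧ x 3 = 0 ∧ x 4 = 0 ∧ x 5 = 0) := by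
      rintro ⟨h0, h1, h2, h3, h4, h5⟩
      refine hx (funext fun j => ?_)
      fin_cases j <;> simpa
    rcases p0 with ⟨a0, a3⟩ | ⟨hc, a0⟩ <;> rcases p1 with ⟨a1, a4⟩ | ⟨hc', a1⟩ <;>
      rcases p2 with ⟨a2, a5⟩ | ⟨hc'', a2⟩ <;> grind

/-- The same count, with an extra `4 c²` when `x 2 = 2 * c`. If `β = 0`, the point can only be the
vertex of the cone, which the Fermat cubic avoids. -/
theorem independent_coneQuadric {x : Fin 6 → ℂ} (hx : x ≠ 0) (hq : eval x coneQuadric = 0)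
    (hf : eval x (fermatCubic 6) = 0)
    {α β : ℂ} (h : α • differential coneQuadric x + β • differential (fermatCubic 6) x = 0) :
    α = 0 ∧ β = 0 := by
  have h' : ∀ v, α * differential coneQuadric x v + β * ∑ i, 3 * x i ^ 2 * v i = 0 := fun v => by
    rw [← differential_fermatCubic]
    exact LinearMap.congr_fun h v
  have hi := fun i => h' (Pi.single i 1)
  simp [coneQuadric, differential_X_apply, Pi.single_apply, pow_two] at hi
  have e0 := hi 0
  have e1 := hi 1
  have e2 := hi 2
  have e3 := hi 3
  have e4 := hi 4
  have e5 := hi 5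
  simp at e0 e1 e2 e3 e4 e5
  rw [eval_fermatCubic, Fin.sum_univ_six] at hf
  have hx' : ¬ (x 0 = 0 ∧ x 1 = 0 ∧ x 2 = 0 ∧ x 3 = 0 ∧ x 4 = 0 ∧ x 5 = 0) := by
    rintro ⟨h0, h1, h2, h3, h4, h5⟩
    refine hx (funext fun j => ?_)
    fin_cases j <;> simpa
  by_cases hβ : β = 0
  · refine ⟨?_, hβ⟩
    by_contra hα
    subst hβ
    have h0 : x 0 = 0 := by simpa [hα] using e3
    have h1 : x 1 = 0 := by simpa [hα] using e4
    have h2 : x 2 = 0 := by grind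
    have h3 : x 3 = 0 := by simpa [hα] using e0
    have h4 : x 4 = 0 := by simpa [hα] using e1
    have h5 : x 5 = 0 := by simpa [h0, h1, h2, h3, h4] using hf
    exact hx' ⟨h0, h1, h2, h3, h4, h5⟩
  · exfalso
    rw [eval_coneQuadric] at hq
    obtain ⟨c, rfl⟩ : ∃ c, α = -3 * β * c := ⟨-α / (3 * β), by field_simp⟩
    have p0 := pair_dichotomy (a := x 0) (b := x 3) (c := c) (by grind) (by grind)
    have p1 := pair_dichotomy (a := x 1) (b := x 4) (c := c) (by grind) (by grind)
    have h5 : x 5 = 0 := by grind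
    have p2 : x 2 = 0 ∨ x 2 = 2 * c := by grind
    rcases p0 with ⟨a0, a3⟩ | ⟨hc, a0⟩ <;> rcases p1 with ⟨a1, a4⟩ | ⟨hc', a1⟩ <;>
      rcases p2 with a2 | a2 <;> grind

end Smoothness

/-! ### Transport along a linear change of coordinates. -/

section Transport

variable {q Q f : Coord} (A : (Fin 6 → ℂ) ≃ₗ[ℂ] (Fin 6 → ℂ))

theorem linearCombination_single (A : (Fin 6 → ℂ) →ₗ[ℂ] (Fin 6 → ℂ)) :
    Fintype.linearCombination ℂ (fun i => A (Pi.single i 1)) = A := by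
  refine LinearMap.ext fun y => ?_
  conv_rhs => rw [pi_eq_sum_univ' y]
  simp [Fintype.linearCombination_apply, map_sum]

theorem planesOn_eq_image (hA : ∀ y, eval (A y) q = eval y Q) : planesOn q =
    Submodule.map (A : (Fin 6 → ℂ) →ₗ[ℂ] (Fin 6 → ℂ)) '' planesOn Q := by
  ext W
  constructor
  · rintro ⟨hW3, hW⟩
    refine ⟨W.map (A.symm : (Fin 6 → ℂ) →ₗ[ℂ] (Fin 6 → ℂ)), ⟨?_, ?_⟩, ?_⟩
    · rw [← hW3]
      exact LinearEquiv.finrank_map_eq A.symm W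
    · rintro _ ⟨x, hx, rfl⟩
      rw [← hA]
      simpa using hW x hx
    · rw [← Submodule.map_comp]
      simp
  · rintro ⟨W, ⟨hW3, hW⟩, rfl⟩
    refine ⟨by rw [← hW3]; exact LinearEquiv.finrank_map_eq A W, ?_⟩
    rintro _ ⟨x, hx, rfl⟩
    exact (hA x).trans (hW x hx)

theorem isV6_of_equiv {f₀ : Coord} (hq : q.IsHomogeneous 2) (hf : f.IsHomogeneous 3)
    (hA : ∀ y, eval (A y) q = eval y Q) (hAf : ∀ y, eval (A y) f = eval y f₀)
    (h : ∀ x ≠ 0, eval x Q = 0 → eval x f₀ = 0 → ∀ α β : ℂ,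
      α • differential Q x + β • differential f₀ x = 0 → α = 0 ∧ β = 0) : IsV6 q f := by
  have hd : ∀ p p₀ : Coord, (∀ y, eval (A y) p = eval y p₀) → ∀ y,
      differential p₀ y = differential p (A y) ∘ₗ A := by
    intro p p₀ hp y
    have h1 := linearCombination_single (A : (Fin 6 → ℂ) →ₗ[ℂ] (Fin 6 → ℂ))
    have h2 : restrict (fun i => (A : (Fin 6 → ℂ) →ₗ[ℂ] (Fin 6 → ℂ)) (Pi.single i 1)) p = p₀ :=
      MvPolynomial.funext fun z => by
        rw [eval_restrict, h1, ← hp]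
        rfl
    have h3 := differential_restrict
      (fun i => (A : (Fin 6 → ℂ) →ₗ[ℂ] (Fin 6 → ℂ)) (Pi.single i 1)) p y
    rwa [h2, h1] at h3
  refine isV6_of_independent hq hf fun x hx hqx hfx α β hαβ => ?_
  obtain ⟨y, rfl⟩ := A.surjective x
  refine h y (fun h0 => hx (by rw [h0, map_zero])) (by rw [← hA, hqx]) (by rw [← hAf, hfx]) α β ?_
  rw [hd q Q hA, hd f f₀ hAf, ← LinearMap.smul_comp, ← LinearMap.smul_comp, ← LinearMap.add_comp,
    hαβ, LinearMap.zero_comp]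

/-- The Fermat cubic in the coordinates given by `A`. -/
theorem exists_fermat : ∃ f : Coord, f.IsHomogeneous 3 ∧
    ∀ y, eval (A y) f = eval y (fermatCubic 6) := by
  refine ⟨restrict (fun i => (A.symm : (Fin 6 → ℂ) →ₗ[ℂ] (Fin 6 → ℂ)) (Pi.single i 1))
    (fermatCubic 6), restrict_isHomogeneous _ (fermatCubic_isHomogeneous 6), fun y => ?_⟩
  rw [eval_restrict, linearCombination_single]
  simp

end Transport

/-! ### Genericity in the cubic and in the plane. -/

section General

/-- The cubic form with indeterminate coefficients. -/
noncomputable def genericCubic : MvPolynomial (Fin 6) (MvPolynomial (Fin 6 →₀ ℕ) ℂ) :=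
  ∑ m ∈ (Finset.univ : Finset (Fin 6)).finsuppAntidiag 3, monomial m (X m)

theorem map_genericCubic {f : Coord} (hf : f.IsHomogeneous 3) :
    map (eval fun m => coeff m f) genericCubic = f := by
  conv_rhs => rw [f.as_sum]
  simp only [genericCubic, map_sum, map_monomial, eval_X]
  symm
  refine Finset.sum_subset (fun m hm => ?_) fun m _ hm => ?_
  · rw [Finset.mem_finsuppAntidiag]
    refine ⟨?_, Finset.subset_univ _⟩
    rw [← Finsupp.degree_eq_sum]
    by_contra h
    exact (mem_support_iff.1 hm) (hf.coeff_eq_zero h)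
  · rw [notMem_support_iff.1 hm, monomial_zero]

/-- The condition that the section by the span of `w` is smooth, in terms of the coefficients of
the cubic form. -/
theorem exists_coeff_polynomial (w : Fin 3 → Fin 6 → ℂ) : ∃ G : MvPolynomial (Fin 6 →₀ ℕ) ℂ,
    ∀ f : Coord, f.IsHomogeneous 3 →
      eval (fun m => coeff m f) G = macaulayMinor (restrict w f) := by
  refine ⟨macaulayMinor (restrict (fun a j => C (w a j)) genericCubic), fun f hf => ?_⟩
  rw [map_macaulayMinor, map_restrict, map_genericCubic hf]
  simp

theorem eval_smul_of_isHomogeneous {n d : ℕ} {p : MvPolynomial (Fin n) ℂ}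
    (hp : p.IsHomogeneous d) (c : ℂ) (t : Fin n → ℂ) : eval (c • t) p = c ^ d * eval t p := by
  rw [eval_eq', eval_eq', Finset.mul_sum]
  refine Finset.sum_congr rfl fun m hm => ?_
  have hdeg : ∑ i, m i = d := by
    rw [← Finsupp.degree_eq_sum]
    by_contra h
    exact (mem_support_iff.1 hm) (hp.coeff_eq_zero h)
  simp only [Pi.smul_apply, smul_eq_mul, mul_pow, Finset.prod_mul_distrib,
    Finset.prod_pow_eq_pow_sum, hdeg]
  ring

theorem forGeneralPoint_of_polynomial {P : Projectivization ℂ (Fin 4 → ℂ) → Prop}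
    (h : MvPolynomial (Fin 4) ℂ) (h0 : h ≠ 0)
    (hP : ∀ (t : Fin 4 → ℂ) (ht : t ≠ 0), eval t h ≠ 0 → P (Projectivization.mk ℂ t ht)) :
    ForGeneralPoint P := by
  obtain ⟨d, hd⟩ : ∃ d, homogeneousComponent d h ≠ 0 := by
    by_contra! hall
    exact h0 (by rw [← sum_homogeneousComponent h]; exact Finset.sum_eq_zero fun i _ => hall i)
  refine ⟨homogeneousComponent d h, hd, ⟨d, homogeneousComponent_isHomogeneous d h⟩,
    fun t ht htd => ?_⟩
  -- Along the line through `t`, `c ↦ h (c • t)` is a polynomial with nonzero coefficient in degree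
  -- `d`. It is thus nonzero at some `c ≠ 0`, which gives the same projective point.
  set r : Polynomial ℂ := ∑ i ∈ Finset.range (h.totalDegree + 1),
    Polynomial.monomial i (eval t (homogeneousComponent i h)) with hr
  have hscale : ∀ c : ℂ, eval (c • t) h = r.eval c := by
    intro c
    conv_lhs => rw [← sum_homogeneousComponent h]
    rw [map_sum, hr, Polynomial.eval_finsetSum]
    refine Finset.sum_congr rfl fun i _ => ?_
    rw [Polynomial.eval_monomial, mul_comm]
    exact eval_smul_of_isHomogeneous (homogeneousComponent_isHomogeneous i h) c t
  have hr0 : r ≠ 0 := by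
    intro h0
    have hdle : d < h.totalDegree + 1 := by
      by_contra hlt
      exact hd (homogeneousComponent_eq_zero _ _ (by omega))
    have := congrArg (Polynomial.coeff · d) h0
    simp only [hr, Polynomial.finsetSum_coeff, Polynomial.coeff_monomial, Polynomial.coeff_zero,
      Finset.sum_ite_eq', Finset.mem_range, hdle, if_true] at this
    exact htd this
  obtain ⟨c, hc0, hc⟩ : ∃ c : ℂ, c ≠ 0 ∧ eval (c • t) h ≠ 0 := by
    by_contra! hall
    refine mul_ne_zero Polynomial.X_ne_zero hr0 (Polynomial.funext fun c => ?_)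
    rw [Polynomial.eval_mul, Polynomial.eval_X, ← hscale, Polynomial.eval_zero, mul_eq_zero]
    exact or_iff_not_imp_left.2 (hall c)
  have : Projectivization.mk ℂ t ht = Projectivization.mk ℂ (c • t) (smul_ne_zero hc0 ht) := by
    rw [Projectivization.mk_eq_mk_iff']
    exact ⟨c⁻¹, by rw [inv_smul_smul₀ hc0]⟩
  rw [this]
  exact hP _ _ hc

/-- The minor of the section by the moving plane is a polynomial in `t`, nonzero because of `t₀`.
The factor `X 0` keeps `t` in the chart where the frame spans. -/
theorem forGeneralPoint_of_frame {q f : Coord} {L : (Fin 4 → ℂ) → Submodule ℂ (Fin 6 → ℂ)}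
    (hLc : ∀ (c : ℂ) t, c ≠ 0 → L (c • t) = L t) (hLq : ∀ t ≠ 0, L t ∈ planesOn q)
    (g : Fin 3 → Fin 6 → MvPolynomial (Fin 4) ℂ)
    (hg : ∀ t, t 0 ≠ 0 → Submodule.span ℂ (Set.range fun a => (fun j => eval t (g a j))) = L t)
    (hV : IsV6 q f) (t₀ : Fin 4 → ℂ) (ht₀ : t₀ 0 ≠ 0)
    (hf : macaulayMinor (restrict (fun a j => eval t₀ (g a j)) f) ≠ 0) :
    ForGeneralPoint fun t => IsSmoothPlaneCubic (linearSection q f (onProj L t)) := by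
  have heval : ∀ t, eval t (X 0 * macaulayMinor (restrict g (map C f))) =
      t 0 * macaulayMinor (restrict (fun a j => eval t (g a j)) f) := fun t => by
    have h : map (eval t) (map C f) = f := by
      rw [map_map, show (eval t).comp C = RingHom.id ℂ from RingHom.ext fun c => eval_C c, map_id]
    rw [map_mul, eval_X, map_macaulayMinor, map_restrict, h]
  refine forGeneralPoint_of_polynomial (X 0 * macaulayMinor (restrict g (map C f))) (fun h => ?_)
    fun t ht hne => ?_
  · have := heval t₀
    rw [h, map_zero] at this
    exact mul_ne_zero ht₀ hf this.symm
  · rw [heval] at hne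
    rw [onProj_mk hLc, ← hg t (left_ne_zero_of_mul hne)]
    have hspan := hg t (left_ne_zero_of_mul hne)
    have hfin := (hLq t ht).1
    rw [← hspan] at hfin
    refine hV.isSmoothPlaneCubic (linearIndependent_iff_card_eq_finrank_span.2 ?_)
      (hspan ▸ hLq t ht) (right_ne_zero_of_mul hne)
    rw [Set.finrank, hfin, Fintype.card_fin]

/-- The sections by the planes of the image under `A` of a family with a polynomial frame. -/
theorem exists_general_coeff_polynomial {q Q : Coord} (A : (Fin 6 → ℂ) ≃ₗ[ℂ] (Fin 6 → ℂ))
    (hA : ∀ y, eval (A y) q = eval y Q) {L : (Fin 4 → ℂ) → Submodule ℂ (Fin 6 → ℂ)}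
    (hLc : ∀ (c : ℂ) t, c ≠ 0 → L (c • t) = L t) (hLQ : ∀ t ≠ 0, L t ∈ planesOn Q)
    (g : Fin 3 → Fin 6 → MvPolynomial (Fin 4) ℂ)
    (hg : ∀ t, t 0 ≠ 0 → Submodule.span ℂ (Set.range fun a => (fun j => eval t (g a j))) = L t)
    (t₀ : Fin 4 → ℂ) (ht₀ : t₀ 0 ≠ 0)
    (hfermat : restrict (fun a j => eval t₀ (g a j)) (fermatCubic 6) = fermatCubic 3)
    {f₀ : Coord} (hf₀ : f₀.IsHomogeneous 3) (hAf₀ : ∀ y, eval (A y) f₀ = eval y (fermatCubic 6)) :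
    ∃ G : MvPolynomial (Fin 6 →₀ ℕ) ℂ, eval (fun m => coeff m f₀) G ≠ 0 ∧
      ∀ f, IsV6 q f → eval (fun m => coeff m f) G ≠ 0 → ForGeneralPoint fun t =>
        IsSmoothPlaneCubic (linearSection q f
          (onProj (fun t => (L t).map (A : (Fin 6 → ℂ) →ₗ[ℂ] (Fin 6 → ℂ))) t)) := by
  let A' : (Fin 6 → ℂ) →ₗ[ℂ] (Fin 6 → ℂ) := A
  let g' : Fin 3 → Fin 6 → MvPolynomial (Fin 4) ℂ :=
    fun a j => ∑ k, C (A' (Pi.single k 1) j) * g a k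
  have hg' : ∀ t a, (fun j => eval t (g' a j)) = A' (fun j => eval t (g a j)) := fun t a => by
    conv_rhs => rw [← linearCombination_single A', Fintype.linearCombination_apply]
    ext j
    simp [g', mul_comm]
  -- `G` tests only the plane at `t₀`; from there smoothness spreads to general `t`.
  obtain ⟨G, hG⟩ := exists_coeff_polynomial fun a j => eval t₀ (g' a j)
  refine ⟨G, ?_, fun f hV hf => ?_⟩
  · have h1 : restrict (fun a j => eval t₀ (g' a j)) f₀ = fermatCubic 3 := by
      refine MvPolynomial.funext fun y => ?_
      have h2 : Fintype.linearCombination ℂ (fun a j => eval t₀ (g' a j)) y =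
          A (Fintype.linearCombination ℂ (fun a j => eval t₀ (g a j)) y) := by
        simp only [Fintype.linearCombination_apply, map_sum, map_smul, hg']
        rfl
      rw [eval_restrict, h2, hAf₀, ← hfermat, eval_restrict]
    rw [hG f₀ hf₀, h1, fermatCubic, macaulayMinor_fermat]
    exact pow_ne_zero _ three_ne_zero
  · rw [hG f hV.2.1] at hf
    refine forGeneralPoint_of_frame (fun c t hc => ?_) (fun t ht => ?_) g' (fun t ht => ?_) hV t₀
      ht₀ hf
    · simp only [hLc c t hc]
    · rw [planesOn_eq_image A hA]
      exact ⟨L t, hLQ t ht, rfl⟩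
    · simp only [← hg t ht, Submodule.map_span, ← Set.range_comp]
      exact congrArg (fun w => Submodule.span ℂ (Set.range w)) (funext fun a => hg' t a)

end General

/-! ### The test plane at `[1 : 0 : 0 : 0]` and the assembly of the theorem. -/

section Main

theorem kleinFrame_spans {t : Fin 4 → ℂ} (ht : t 0 ≠ 0) :
    Submodule.span ℂ (Set.range fun a => (fun j => eval t (kleinFrame 0 a j))) = kleinPlane t :=
  le_antisymm (Submodule.span_le.2 (by rintro _ ⟨a, rfl⟩; exact kleinFrame_mem 0 t a))
    (kleinPlane_le_span 0 t ht)

theorem coneFrame_spans {t : Fin 4 → ℂ} (ht : t 0 ≠ 0) :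
    Submodule.span ℂ (Set.range fun a => (fun j => eval t (coneFrame 0 a j))) = conePlane t :=
  le_antisymm (Submodule.span_le.2 (by rintro _ ⟨a, rfl⟩; exact coneFrame_mem 0 t a))
    (conePlane_le_span 0 t ht)

theorem restrict_kleinFrame_fermatCubic :
    restrict (fun a j => eval ![1, 0, 0, 0] (kleinFrame 0 a j)) (fermatCubic 6) =
      fermatCubic 3 := by
  refine MvPolynomial.funext fun y => ?_
  rw [eval_restrict, eval_fermatCubic, eval_fermatCubic, Fintype.linearCombination_apply]
  simp [kleinFrame, Fin.sum_univ_six, Fin.sum_univ_three]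

theorem restrict_coneFrame_fermatCubic :
    restrict (fun a j => eval ![1, 0, 0, 0] (coneFrame 0 a j)) (fermatCubic 6) =
      fermatCubic 3 := by
  refine MvPolynomial.funext fun y => ?_
  rw [eval_restrict, eval_fermatCubic, eval_fermatCubic, Fintype.linearCombination_apply]
  simp [coneFrame, Fin.sum_univ_six, Fin.sum_univ_three]

theorem map_scale {L : (Fin 4 → ℂ) → Submodule ℂ (Fin 6 → ℂ)}
    (hLc : ∀ (c : ℂ) t, c ≠ 0 → L (c • t) = L t) (A : (Fin 6 → ℂ) →ₗ[ℂ] (Fin 6 → ℂ)) (c : ℂ)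
    (t : Fin 4 → ℂ) (hc : c ≠ 0) : (L (c • t)).map A = (L t).map A := by
  rw [hLc c t hc]

end Main

end FanoGenusFour

theorem mainTheorem6 :
    (∀ q : Coord, q.IsHomogeneous 2 → quadricRank q = 6 →
      ∃ Λ₁ Λ₂ : Projectivization ℂ (Fin 4 → ℂ) → Submodule ℂ (Fin 6 → ℂ),
        IsP3Family Λ₁ ∧ IsP3Family Λ₂ ∧
        Disjoint (Set.range Λ₁) (Set.range Λ₂) ∧
        Set.range Λ₁ ∪ Set.range Λ₂ = planesOn q ∧
        (∀ f : Coord, IsV6 q f →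
          Function.Injective (fun t => linearSection q f (Λ₁ t)) ∧
          Function.Injective (fun t => linearSection q f (Λ₂ t)) ∧
          Disjoint (Set.range fun t => linearSection q f (Λ₁ t))
            (Set.range fun t => linearSection q f (Λ₂ t)) ∧
          (Set.range fun t => linearSection q f (Λ₁ t)) ∪
            (Set.range fun t => linearSection q f (Λ₂ t)) = planeCubicsOn q f) ∧
        ForGeneralV6 q (fun f =>
          ForGeneralPoint (fun t => IsSmoothPlaneCubic (linearSection q f (Λ₁ t))) ∧
          ForGeneralPoint (fun t => IsSmoothPlaneCubic (linearSection q f (Λ₂ t))))) ∧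
    (∀ q : Coord, q.IsHomogeneous 2 → quadricRank q = 5 →
      ∃ Λ : Projectivization ℂ (Fin 4 → ℂ) → Submodule ℂ (Fin 6 → ℂ),
        IsP3Family Λ ∧
        Set.range Λ = planesOn q ∧
        (∀ f : Coord, IsV6 q f →
          Function.Injective (fun t => linearSection q f (Λ t)) ∧
          (Set.range fun t => linearSection q f (Λ t)) = planeCubicsOn q f) ∧
        ForGeneralV6 q (fun f =>
          ForGeneralPoint (fun t => IsSmoothPlaneCubic (linearSection q f (Λ t))))) := by
  constructor
  · intro q hq hr
    obtain ⟨A, hA⟩ := exists_klein_normalForm hq hr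
    -- The quadric and the Fermat cubic are invariant under the exchange of the halves. The second
    -- family is therefore handled as the first one in the coordinates `A'`, with the same cubic
    -- `f₀`.
    let A' := swapHalves.trans A
    have hA' : ∀ y, MvPolynomial.eval (A' y) q = MvPolynomial.eval y kleinQuadric := fun y => by
      rw [LinearEquiv.trans_apply, hA, eval_kleinQuadric, eval_kleinQuadric, swapHalves_apply]
      simp only [Matrix.cons_val]
      ring
    have hdual : ∀ t, (kleinPlane t).map (A' : (Fin 6 → ℂ) →ₗ[ℂ] (Fin 6 → ℂ)) =
        (dualKleinPlane t).map (A : (Fin 6 → ℂ) →ₗ[ℂ] (Fin 6 → ℂ)) := fun t => by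
      rw [dualKleinPlane, ← Submodule.map_comp]
      rfl
    have hc₁ := map_scale kleinPlane_smul (A : (Fin 6 → ℂ) →ₗ[ℂ] (Fin 6 → ℂ))
    have hc₂ := map_scale kleinPlane_smul (A' : (Fin 6 → ℂ) →ₗ[ℂ] (Fin 6 → ℂ))
    have hP₁ := (isVeroneseFamily_kleinPlane.map_equiv A).isP3Family hc₁
    have hP₂ := (isVeroneseFamily_kleinPlane.map_equiv A').isP3Family hc₂
    have hdisj : Disjoint
        (Set.range (onProj fun t => (kleinPlane t).map (A : (Fin 6 → ℂ) →ₗ[ℂ] (Fin 6 → ℂ))))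
        (Set.range (onProj fun t => (kleinPlane t).map (A' : (Fin 6 → ℂ) →ₗ[ℂ] (Fin 6 → ℂ)))) := by
      rw [range_onProj hc₁, range_onProj hc₂, Set.disjoint_left]
      rintro _ ⟨t, ht, rfl⟩ ⟨t', ht', h⟩
      simp only [hdual] at h
      exact kleinPlane_ne_dualKleinPlane ht ht'
        (Submodule.map_injective_of_injective A.injective h.symm)
    have hunion : Set.range (onProj fun t =>
          (kleinPlane t).map (A : (Fin 6 → ℂ) →ₗ[ℂ] (Fin 6 → ℂ))) ∪
        Set.range (onProj fun t => (kleinPlane t).map (A' : (Fin 6 → ℂ) →ₗ[ℂ] (Fin 6 → ℂ))) =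
        planesOn q := by
      rw [range_onProj hc₁, range_onProj hc₂, planesOn_eq_image A hA, planesOn_kleinQuadric,
        Set.image_union, Set.image_image, Set.image_image]
      simp only [hdual]
    have hmem₁ := fun t => hunion ▸ Set.mem_union_left _ (Set.mem_range_self
      (f := onProj fun t => (kleinPlane t).map (A : (Fin 6 → ℂ) →ₗ[ℂ] (Fin 6 → ℂ))) t)
    have hmem₂ := fun t => hunion ▸ Set.mem_union_right _ (Set.mem_range_self
      (f := onProj fun t => (kleinPlane t).map (A' : (Fin 6 → ℂ) →ₗ[ℂ] (Fin 6 → ℂ))) t)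
    have hstd : ∀ t ≠ 0, kleinPlane t ∈ planesOn kleinQuadric := fun t ht => by
      rw [planesOn_kleinQuadric]
      exact Or.inl ⟨t, ht, rfl⟩
    refine ⟨_, _, hP₁, hP₂, hdisj, hunion, fun f hV => ?_, ?_⟩
    · have hinj := injOn_linearSection (q := q) hV.2.1
      refine ⟨fun t t' h => hP₁.1 (hinj (hmem₁ t) (hmem₁ t') h),
        fun t t' h => hP₂.1 (hinj (hmem₂ t) (hmem₂ t') h), ?_, ?_⟩
      · rw [Set.disjoint_left]
        rintro _ ⟨t, rfl⟩ ⟨t', h⟩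
        exact Set.disjoint_left.1 hdisj ⟨t, rfl⟩ ⟨t', hinj (hmem₂ t') (hmem₁ t) h⟩
      · rw [hV.planeCubicsOn_eq, ← hunion, Set.image_union, ← Set.range_comp, ← Set.range_comp]
        rfl
    · obtain ⟨f₀, hf₀, hAf₀⟩ := exists_fermat A
      have hAf₀' : ∀ y, MvPolynomial.eval (A' y) f₀ = MvPolynomial.eval y (fermatCubic 6) :=
        fun y => by
          rw [LinearEquiv.trans_apply, hAf₀, eval_fermatCubic, eval_fermatCubic, swapHalves_apply]
          simp only [Fin.sum_univ_six, Matrix.cons_val]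
          ring
      obtain ⟨G₁, hG₁, hgen₁⟩ := exists_general_coeff_polynomial A hA kleinPlane_smul hstd
        (kleinFrame 0) (fun t ht => kleinFrame_spans ht) ![1, 0, 0, 0] (by simp)
        restrict_kleinFrame_fermatCubic hf₀ hAf₀
      obtain ⟨G₂, hG₂, hgen₂⟩ := exists_general_coeff_polynomial A' hA' kleinPlane_smul hstd
        (kleinFrame 0) (fun t ht => kleinFrame_spans ht) ![1, 0, 0, 0] (by simp)
        restrict_kleinFrame_fermatCubic hf₀ hAf₀'
      refine ⟨G₁ * G₂, ⟨f₀, isV6_of_equiv A hq hf₀ hA hAf₀ fun x hx hqx _ α β h =>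
        independent_kleinQuadric hx hqx h, ?_⟩, fun f hV hf => ?_⟩
      · rw [map_mul]
        exact mul_ne_zero hG₁ hG₂
      · rw [map_mul] at hf
        exact ⟨hgen₁ f hV (left_ne_zero_of_mul hf), hgen₂ f hV (right_ne_zero_of_mul hf)⟩
  · intro q hq hr
    obtain ⟨A, hA⟩ := exists_cone_normalForm hq hr
    have hc := map_scale conePlane_smul (A : (Fin 6 → ℂ) →ₗ[ℂ] (Fin 6 → ℂ))
    have hP := (isVeroneseFamily_conePlane.map_equiv A).isP3Family hc
    have hrange : Set.range (onProj fun t =>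
        (conePlane t).map (A : (Fin 6 → ℂ) →ₗ[ℂ] (Fin 6 → ℂ))) = planesOn q := by
      rw [range_onProj hc, planesOn_eq_image A hA, planesOn_coneQuadric, Set.image_image]
    have hmem := fun t => hrange ▸ Set.mem_range_self
      (f := onProj fun t => (conePlane t).map (A : (Fin 6 → ℂ) →ₗ[ℂ] (Fin 6 → ℂ))) t
    refine ⟨_, hP, hrange, fun f hV => ?_, ?_⟩
    · refine ⟨fun t t' h => hP.1 (injOn_linearSection hV.2.1 (hmem t) (hmem t') h), ?_⟩
      rw [hV.planeCubicsOn_eq, ← hrange, ← Set.range_comp]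
      rfl
    · obtain ⟨f₀, hf₀, hAf₀⟩ := exists_fermat A
      obtain ⟨G, hG, hgen⟩ := exists_general_coeff_polynomial A hA conePlane_smul
        (fun t ht => planesOn_coneQuadric ▸ ⟨t, ht, rfl⟩)
        (coneFrame 0) (fun t ht => coneFrame_spans ht) ![1, 0, 0, 0] (by simp)
        restrict_coneFrame_fermatCubic hf₀ hAf₀
      exact ⟨G, ⟨f₀, isV6_of_equiv A hq hf₀ hA hAf₀ fun x hx hqx hfx α β h =>
        independent_coneQuadric hx hqx hfx h, hG⟩, hgen⟩
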